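/- Let $m\in\mathbb{Z}$, let $n_1,n_2>0$ be real numbers (the values $n_1(\xi)$, $n_2(\xi)$ of the refractive index on the two sides of the jump point $\xi$), and let $\mathbb{C}^*_{\ge 0}:=\{\zeta\in\mathbb{C}\setminus\{0\} : \operatorname{Im}\zeta\ge 0\}$. Let $J_m$ be the Bessel function of the first kind and $H_m:=H^{(1)}_m=J_m+\mathrm{i}Y_m$ the Hankel function of the first kind of order $m$, where the branch cut of $H_m$ is the negative imaginary axis ($-\pi/2<\arg z<3\pi/2$), so that $H_m$ is analytic in a neighbourhood of $\mathbb{C}^*_{\ge 0}$ and equals its principal value on $\mathbb{C}^*_{\ge0}$. Then for every $k\in\mathbb{C}^*_{\ge 0}$ and every $\xi\in(0,1)$, $$J_m'(k\xi n_1)-\mathrm{i}J_m(k\xi n_1)\ne 0\qquad\text{and}\qquad H_m'(k\xi n_2)+\mathrm{i}H_m(k\xi n_2)\ne 0 .$$ Hence the scaling constants $c_{1,k}$ and $c_{2,k}$ are well defined, that is, there are unique nonzero complex numbers $c_{1,k}$, $c_{2,k}$ with $$\frac1{c_{1,k}}=k n_1\bigl[J_m'(k\xi n_1)-\mathrm{i}J_m(k\xi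 n_1)\bigr],\qquad \frac1{c_{2,k}}=-k n_2\bigl[H_m'(k\xi n_2)+\mathrm{i}H_m(k\xi n_2)\bigr].$$ -/

import Mathlib

open Complex
open scoped Nat

noncomputable section

/-- The nonzero complex numbers with nonnegative imaginary part. -/
def CStarNonneg : Set ℂ := {ζ | ζ ≠ 0 ∧ 0 ≤ ζ.im}

/-- The branch of the logarithm with argument in `(-π/2, 3π/2]`. Its cut is the negative imaginary
axis, so that it is analytic near every nonzero point of the closed upper half plane. -/
def logUp (z : ℂ) : ℂ := log (-I * z) + I * (Real.pi / 2)

/-- The Bessel function `J_n` of the first kind, for a natural order `n`. -/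
def besselJNat (n : ℕ) (z : ℂ) : ℂ :=
  ∑' j : ℕ, (-1) ^ j / ((j ! : ℂ) * ((j + n)! : ℂ)) * (z / 2) ^ (2 * j + n)

/-- The value `ψ(j + 1) = -γ + 1 + 1/2 + ... + 1/j` of the digamma function. -/
def digammaSucc (j : ℕ) : ℝ := (harmonic j : ℝ) - Real.eulerMascheroniConstant

/-- The Bessel function `Y_n` of the second kind, for a natural order `n`, with the branch
`logUp` of the logarithm. On `CStarNonneg` this is the principal value of `Y_n`
(see `logUp_eq_log`). -/
def besselYNat (n : ℕ) (z : ℂ) : ℂ :=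
  (2 / Real.pi : ℂ) * logUp (z / 2) * besselJNat n z
    - (1 / Real.pi : ℂ) *
      ∑ j ∈ Finset.range n, (((n - 1 - j)! : ℂ) / (j ! : ℂ)) * ((z / 2) ^ (2 * j) / (z / 2) ^ n)
    - (1 / Real.pi : ℂ) *
      ∑' j : ℕ, (-1) ^ j * ((digammaSucc j : ℂ) + (digammaSucc (j + n) : ℂ))
        / ((j ! : ℂ) * ((j + n)! : ℂ)) * (z / 2) ^ (2 * j + n)

/-- The factor in the reflection formulas `J_{-n} = (-1)^n J_n`, `Y_{-n} = (-1)^n Y_n`. -/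
def orderSign (m : ℤ) : ℂ := if m < 0 then (-1) ^ m.natAbs else 1

/-- The Bessel function `J_m` of the first kind, of integer order `m`. -/
def besselJ (m : ℤ) (z : ℂ) : ℂ := orderSign m * besselJNat m.natAbs z

/-- The Bessel function `Y_m` of the second kind, of integer order `m`. -/
def besselY (m : ℤ) (z : ℂ) : ℂ := orderSign m * besselYNat m.natAbs z

/-- The Hankel function `H_m = J_m + i Y_m` of the first kind, of integer order `m`. -/
def hankelH (m : ℤ) (z : ℂ) : ℂ := besselJ m z + I * besselY m z

/-- On the closed upper half plane `logUp` is the principal branch of the logarithm. -/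
theorem logUp_eq_log {z : ℂ} (hz : z ∈ CStarNonneg) : logUp z = log z := by
  obtain ⟨h0, him⟩ := hz
  have h1 : (-I) ≠ 0 := by simp
  have harg : 0 ≤ arg z := arg_nonneg_iff.mpr him
  have hpi := arg_le_pi z
  have hp := Real.pi_pos
  have h2 : arg (-I) + arg z ∈ Set.Ioc (-Real.pi) Real.pi := by
    rw [arg_neg_I]
    constructor <;> linarith
  rw [logUp, log_mul h1 h0 h2, log_neg_I]
  ring

theorem differentiableAt_logUp {z : ℂ} (hz : z ∈ CStarNonneg) : DifferentiableAt ℂ logUp z := by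
  obtain ⟨h0, him⟩ := hz
  have h1 : -I * z ∈ slitPlane := by
    rw [mem_slitPlane_iff]
    simp only [neg_mul, neg_re, neg_im, mul_re, mul_im, I_re, I_im]
    by_cases h : z.re = 0
    · left
      have : z.im ≠ 0 := fun h' => h0 (Complex.ext h h')
      have : 0 < z.im := lt_of_le_of_ne him (Ne.symm this)
      linarith
    · right
      simpa using h
  unfold logUp
  exact ((differentiableAt_id.const_mul (-I)).clog h1).add_const _

/-- The power series above define entire functions. -/
theorem differentiable_series (a : ℕ → ℂ) (n : ℕ) (C : ℝ) (ha : ∀ j, ‖a j‖ ≤ C / j !) :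
    Differentiable ℂ (fun z : ℂ => ∑' j : ℕ, a j * (z / 2) ^ (2 * j + n)) := by
  intro z
  have hs : Summable (fun j : ℕ => C * ((‖z‖ + 1) ^ n) * (((‖z‖ + 1) ^ 2) ^ j / j !)) :=
    (Real.summable_pow_div_factorial _).mul_left _
  refine (differentiableOn_tsum_of_summable_norm (U := Metric.ball 0 (‖z‖ + 1)) hs ?_
    Metric.isOpen_ball ?_).differentiableAt (Metric.isOpen_ball.mem_nhds (by simp))
  · intro j
    fun_prop
  · intro j w hw
    have hw' : ‖w‖ < ‖z‖ + 1 := by simpa using hw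
    have h2 : ‖w / 2‖ ≤ ‖z‖ + 1 := by
      rw [norm_div]
      have := norm_nonneg w
      simp only [Complex.norm_ofNat]
      linarith
    rw [norm_mul, norm_pow]
    calc ‖a j‖ * ‖w / 2‖ ^ (2 * j + n) ≤ C / j ! * (‖z‖ + 1) ^ (2 * j + n) := by
          gcongr
          · exact (norm_nonneg _).trans (ha j)
          · exact ha j
      _ = _ := by rw [pow_add, pow_mul]; ring

theorem differentiable_besselJNat (n : ℕ) : Differentiable ℂ (besselJNat n) := by
  refine differentiable_series _ n 1 fun j => ?_
  rw [norm_div, norm_mul, norm_pow, norm_neg, norm_one, one_pow, norm_natCast, norm_natCast]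
  have h1 : (1 : ℝ) ≤ ((j + n)! : ℝ) := by exact_mod_cast Nat.one_le_iff_ne_zero.mpr (by positivity)
  have h2 : (0 : ℝ) < (j ! : ℝ) := by positivity
  gcongr
  nlinarith

theorem abs_digammaSucc_le (j : ℕ) : |digammaSucc j| ≤ j + 1 := by
  have h1 : harmonic j ≤ (j : ℚ) := by
    unfold harmonic
    calc ∑ i ∈ Finset.range j, ((↑(i + 1) : ℚ))⁻¹ ≤ ∑ i ∈ Finset.range j, (1 : ℚ) := by
          refine Finset.sum_le_sum fun i _ => inv_le_one_of_one_le₀ ?_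
          push_cast
          have : (0 : ℚ) ≤ i := Nat.cast_nonneg i
          linarith
      _ = j := by simp
  have h1' : ((harmonic j : ℚ) : ℝ) ≤ j := by exact_mod_cast h1
  have h0 : (0 : ℚ) ≤ harmonic j := by
    unfold harmonic
    positivity
  have h0' : (0 : ℝ) ≤ ((harmonic j : ℚ) : ℝ) := by exact_mod_cast h0
  have h3 := Real.one_half_lt_eulerMascheroniConstant
  have h4 := Real.eulerMascheroniConstant_lt_two_thirds
  have h5 : (0 : ℝ) ≤ j := Nat.cast_nonneg j
  rw [digammaSucc, abs_le]
  constructor <;> linarith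

theorem differentiableAt_besselYNat (n : ℕ) {z : ℂ} (hz : z ∈ CStarNonneg) :
    DifferentiableAt ℂ (besselYNat n) z := by
  have hz2 : z / 2 ∈ CStarNonneg := by
    refine ⟨div_ne_zero hz.1 two_ne_zero, ?_⟩
    have := hz.2
    simp only [div_ofNat_im]
    positivity
  have hser : Differentiable ℂ (fun z : ℂ => ∑' j : ℕ,
      (-1) ^ j * ((digammaSucc j : ℂ) + (digammaSucc (j + n) : ℂ))
        / ((j ! : ℂ) * ((j + n)! : ℂ)) * (z / 2) ^ (2 * j + n)) := by
    refine differentiable_series _ n 4 fun j => ?_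
    have h1 : ‖(digammaSucc j : ℂ) + (digammaSucc (j + n) : ℂ)‖ ≤ 4 * ((j + n)! : ℝ) := by
      refine (norm_add_le _ _).trans ?_
      rw [norm_real, norm_real, Real.norm_eq_abs, Real.norm_eq_abs]
      have a1 := abs_digammaSucc_le j
      have a2 := abs_digammaSucc_le (j + n)
      have a3 : ((j + n : ℕ) : ℝ) ≤ ((j + n)! : ℝ) := by exact_mod_cast Nat.self_le_factorial _
      have a4 : (1 : ℝ) ≤ ((j + n)! : ℝ) := by
        exact_mod_cast Nat.one_le_iff_ne_zero.mpr (by positivity)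
      push_cast at a2 a3
      have a5 : (0 : ℝ) ≤ n := Nat.cast_nonneg n
      linarith
    rw [norm_div, norm_mul, norm_mul, norm_pow, norm_neg, norm_one, one_pow, one_mul,
      norm_natCast, norm_natCast, div_le_div_iff₀ (by positivity) (by positivity)]
    have h2 : (0 : ℝ) < (j ! : ℝ) := by positivity
    nlinarith
  have hlog : DifferentiableAt ℂ (fun w : ℂ => logUp (w / 2)) z :=
    (differentiableAt_logUp hz2).comp z (f := fun w : ℂ => w / 2) (by fun_prop)
  have hJ := (differentiable_besselJNat n) z
  have hfin : DifferentiableAt ℂ (fun z : ℂ => ∑ j ∈ Finset.range n,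
      (((n - 1 - j)! : ℂ) / (j ! : ℂ)) * ((z / 2) ^ (2 * j) / (z / 2) ^ n)) z := by
    refine DifferentiableAt.fun_sum fun j _ => ?_
    refine DifferentiableAt.const_mul ?_ _
    exact DifferentiableAt.fun_div (by fun_prop) (by fun_prop) (pow_ne_zero _ hz2.1)
  unfold besselYNat
  exact (((hlog.const_mul _).mul hJ).sub (hfin.const_mul _)).sub ((hser z).const_mul _)

/-- `J_m` is entire. -/
theorem differentiable_besselJ (m : ℤ) : Differentiable ℂ (besselJ m) :=
  (differentiable_besselJNat _).const_mul _

/-- `H_m` is complex differentiable at every point of `CStarNonneg`, in a full neighbourhood also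
at negative real points; so `deriv (hankelH m)` is a genuine derivative there. -/
theorem differentiableAt_hankelH (m : ℤ) {z : ℂ} (hz : z ∈ CStarNonneg) :
    DifferentiableAt ℂ (hankelH m) z :=
  ((differentiable_besselJ m) z).add
    (((differentiableAt_besselYNat _ hz).const_mul _).const_mul I)

end

open ComplexConjugate

noncomputable section

/-! Both non-vanishing claims are sign arguments for `C_n' conj C_n`, based on Bessel's equation in
the form `z (z C_n')' = (n² - z²) C_n`. The sign `orderSign m` reduces everything to natural orders.

For `H_n`, consider `F = Re (z H_n' conj H_n)`. On a semicircle `|z| = r` its angular derivative is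
`Im (z²) |H_n|²`, so `F` is largest on the imaginary axis. There `H_n` is a constant phase times a
multiple of the positive decreasing function `K_n`, so `F < 0` on the whole closed half plane
(`re_eulerDeriv_hankelNat_neg`). If `H_n' = -i H_n`, then `F = Im z |H_n|² ≥ 0`, a contradiction.

For `J_n`, consider `G(t) = Im (conj z · D(zt) conj J_n(zt))` with `D(z) = z J_n'(z)`. It vanishes
at `t = 0` and is nonincreasing, so `G(1) ≤ 0`. If `J_n' = i J_n` at `z`, then `G(1) = |z|² |J_n|²`,
which forces `J_n = J_n' = 0`, impossible since `J_n` and `J_{n+1}` have no common zero.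

The remaining work derives the recurrences between orders from the series and proves `K_0, K_1 > 0`,
also from the series. -/

/-! ### Derivatives of the power series behind `J_n` and `Y_n`. -/

theorem summable_of_le_factorial {a : ℕ → ℂ} {C : ℝ} (ha : ∀ j, ‖a j‖ ≤ C / j !) (w : ℂ) :
    Summable fun j => a j * w ^ j := by
  refine Summable.of_norm_bounded (g := fun j => C * (‖w‖ ^ j / j !))
    ((Real.summable_pow_div_factorial _).mul_left _) fun j => ?_
  rw [norm_mul, norm_pow]
  calc ‖a j‖ * ‖w‖ ^ j ≤ C / j ! * ‖w‖ ^ j := by gcongr; exact ha j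
    _ = _ := by ring

theorem hasDerivAt_powerSeries {a : ℕ → ℂ} {C : ℝ} (ha : ∀ j, ‖a j‖ ≤ C / j !) (w : ℂ) :
    HasDerivAt (fun w : ℂ => ∑' j, a j * w ^ j) (∑' j : ℕ, ((j : ℂ) + 1) * a (j + 1) * w ^ j) w := by
  have hu : Summable fun j : ℕ => C * ((‖w‖ + 1) ^ j / j !) :=
    (Real.summable_pow_div_factorial _).mul_left _
  have hd : ∀ j : ℕ, DifferentiableOn ℂ (fun w : ℂ => a j * w ^ j) (Metric.ball 0 (‖w‖ + 1)) :=
    fun j => by fun_prop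
  have hb : ∀ (j : ℕ) (v : ℂ), v ∈ Metric.ball (0 : ℂ) (‖w‖ + 1) →
      ‖a j * v ^ j‖ ≤ C * ((‖w‖ + 1) ^ j / j !) := by
    intro j v hv
    have hv' : ‖v‖ ≤ ‖w‖ + 1 := by simpa using (Metric.mem_ball.1 hv).le
    rw [norm_mul, norm_pow]
    calc ‖a j‖ * ‖v‖ ^ j ≤ C / j ! * (‖w‖ + 1) ^ j := by
          gcongr
          · exact (norm_nonneg _).trans (ha j)
          · exact ha j
      _ = _ := by ring
  have hw : w ∈ Metric.ball (0 : ℂ) (‖w‖ + 1) := by simp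
  have h1 := hasSum_deriv_of_summable_norm hu hd Metric.isOpen_ball hb hw
  have h2 := ((differentiableOn_tsum_of_summable_norm hu hd Metric.isOpen_ball hb).differentiableAt
    (Metric.isOpen_ball.mem_nhds hw)).hasDerivAt
  have h3 : ∀ j : ℕ, deriv (fun w : ℂ => a j * w ^ j) w = a j * (j * w ^ (j - 1)) := by
    intro j
    simp
  simp only [h3] at h1
  rw [← h1.tsum_eq, h1.summable.tsum_eq_zero_add] at h2
  refine h2.congr_deriv ?_
  simp only [Nat.cast_zero, zero_mul, mul_zero, zero_add]
  refine tsum_congr fun j => ?_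
  push_cast
  ring

/-- The coefficients of the entire function `f` with `J_n(z) = (z/2)^n f((z/2)^2)`. -/
def jCoeff (n j : ℕ) : ℂ := (-1) ^ j / ((j ! : ℂ) * ((j + n)! : ℂ))

/-- The coefficients of the power series in the definition of `Y_n`. -/
def yCoeff (n j : ℕ) : ℂ :=
  (-1) ^ j * ((digammaSucc j : ℂ) + (digammaSucc (j + n) : ℂ)) / ((j ! : ℂ) * ((j + n)! : ℂ))

theorem norm_jCoeff_le (n j : ℕ) : ‖jCoeff n j‖ ≤ 1 / j ! := by
  rw [jCoeff, norm_div, norm_mul, norm_pow, norm_neg, norm_one, one_pow, norm_natCast, norm_natCast]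
  have h1 : (1 : ℝ) ≤ ((j + n)! : ℝ) := by exact_mod_cast Nat.one_le_iff_ne_zero.mpr (by positivity)
  have h2 : (0 : ℝ) < (j ! : ℝ) := by positivity
  gcongr
  nlinarith

theorem norm_yCoeff_le (n j : ℕ) : ‖yCoeff n j‖ ≤ 4 / j ! := by
  have h1 : ‖(digammaSucc j : ℂ) + (digammaSucc (j + n) : ℂ)‖ ≤ 4 * ((j + n)! : ℝ) := by
    refine (norm_add_le _ _).trans ?_
    rw [norm_real, norm_real, Real.norm_eq_abs, Real.norm_eq_abs]
    have a1 := abs_digammaSucc_le j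
    have a2 := abs_digammaSucc_le (j + n)
    have a3 : ((j + n : ℕ) : ℝ) ≤ ((j + n)! : ℝ) := by exact_mod_cast Nat.self_le_factorial _
    have a4 : (1 : ℝ) ≤ ((j + n)! : ℝ) := by
      exact_mod_cast Nat.one_le_iff_ne_zero.mpr (by positivity)
    push_cast at a2 a3
    have a5 : (0 : ℝ) ≤ n := Nat.cast_nonneg n
    linarith
  rw [yCoeff, norm_div, norm_mul, norm_mul, norm_pow, norm_neg, norm_one, one_pow, one_mul,
    norm_natCast, norm_natCast, div_le_div_iff₀ (by positivity) (by positivity)]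
  have h2 : (0 : ℝ) < (j ! : ℝ) := by positivity
  nlinarith

def jSeries (n : ℕ) (w : ℂ) : ℂ := ∑' j, jCoeff n j * w ^ j

def ySeries (n : ℕ) (w : ℂ) : ℂ := ∑' j, yCoeff n j * w ^ j

theorem factorial_cast_succ (n : ℕ) : ((n + 1)! : ℂ) = (n + 1) * (n ! : ℂ) := by
  rw [Nat.factorial_succ]; push_cast; ring

theorem digammaSucc_succ (j : ℕ) : digammaSucc (j + 1) = digammaSucc j + 1 / (j + 1) := by
  rw [digammaSucc, digammaSucc, harmonic_succ]
  push_cast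
  rw [one_div]
  ring

theorem jCoeff_succ_left (n j : ℕ) : ((j : ℂ) + 1) * jCoeff n (j + 1) = -jCoeff (n + 1) j := by
  have e : j + 1 + n = j + (n + 1) := by ring
  have h1 : (j ! : ℂ) ≠ 0 := Nat.cast_ne_zero.2 (Nat.factorial_ne_zero _)
  have h2 : ((j + (n + 1))! : ℂ) ≠ 0 := Nat.cast_ne_zero.2 (Nat.factorial_ne_zero _)
  have h3 : (j : ℂ) + 1 ≠ 0 := Nat.cast_add_one_ne_zero j
  rw [jCoeff, jCoeff, e, factorial_cast_succ j]
  field_simp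
  ring

theorem hasDerivAt_jSeries (n : ℕ) (w : ℂ) : HasDerivAt (jSeries n) (-jSeries (n + 1) w) w := by
  have h := hasDerivAt_powerSeries (norm_jCoeff_le n) w
  refine h.congr_deriv ?_
  simp only [jCoeff_succ_left, neg_mul, tsum_neg]
  rfl

/-- Since `ψ(j + 2) = ψ(j + 1) + 1 / (j + 1)`, the derivative of `ySeries` picks up a remainder
which is a difference quotient of `jSeries`. -/
theorem hasDerivAt_ySeries (n : ℕ) {w : ℂ} (hw : w ≠ 0) :
    HasDerivAt (ySeries n) (-ySeries (n + 1) w + (jSeries n w - 1 / (n ! : ℂ)) / w) w := by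
  have h := hasDerivAt_powerSeries (norm_yCoeff_le n) w
  refine h.congr_deriv ?_
  symm
  have hJ := summable_of_le_factorial (norm_jCoeff_le n) w
  have hY := summable_of_le_factorial (norm_yCoeff_le (n + 1)) w
  have e1 : (jSeries n w - 1 / (n ! : ℂ)) / w = ∑' j, jCoeff n (j + 1) * w ^ j := by
    rw [jSeries, hJ.tsum_eq_zero_add]
    have : ∀ j, jCoeff n (j + 1) * w ^ (j + 1) = jCoeff n (j + 1) * w ^ j * w :=
      fun j => by ring
    simp only [this, tsum_mul_right]
    rw [div_eq_iff hw]
    simp [jCoeff]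
  have hJ' : Summable fun j => jCoeff n (j + 1) * w ^ j := by
    have := ((summable_nat_add_iff 1).2 hJ).mul_right w⁻¹
    refine this.congr fun j => ?_
    field_simp
    ring
  rw [e1, ySeries, ← tsum_neg, ← hY.neg.tsum_add hJ']
  refine tsum_congr fun j => ?_
  have e : j + 1 + n = j + n + 1 := by ring
  have e' : j + (n + 1) = j + n + 1 := by ring
  have h1 : (j ! : ℂ) ≠ 0 := Nat.cast_ne_zero.2 (Nat.factorial_ne_zero _)
  have h2 : ((j + n + 1)! : ℂ) ≠ 0 := Nat.cast_ne_zero.2 (Nat.factorial_ne_zero _)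
  have h3 : (j : ℂ) + 1 ≠ 0 := Nat.cast_add_one_ne_zero j
  rw [yCoeff, yCoeff, jCoeff, e, e', factorial_cast_succ j, digammaSucc_succ j]
  push_cast
  field_simp
  ring

/-- Used for the recurrence that lowers the order from 1 to 0, where the extra factor `w` turns `1 /
(j + 1)!` into `1 / j !`. -/
theorem hasDerivAt_mul_powerSeries {a : ℕ → ℂ} {C : ℝ} (ha : ∀ j, ‖a j‖ ≤ C / j !) (w : ℂ) :
    HasDerivAt (fun w : ℂ => w * ∑' j, a j * w ^ j) (∑' j : ℕ, ((j : ℂ) + 1) * a j * w ^ j) w := by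
  have hs := summable_of_le_factorial ha w
  have hb : ∀ j : ℕ, ‖((j : ℂ) + 1) * a (j + 1)‖ ≤ C / j ! := by
    intro j
    have h1 : ‖(j : ℂ) + 1‖ = j + 1 := by
      have := norm_natCast (j + 1) (α := ℂ)
      push_cast at this
      exact this
    have h2 := ha (j + 1)
    rw [norm_mul, h1]
    calc ((j : ℝ) + 1) * ‖a (j + 1)‖ ≤ (j + 1) * (C / (j + 1)!) := by gcongr
      _ = C / j ! := by
        rw [Nat.factorial_succ]
        push_cast
        field_simp
  have hs1 : Summable fun j : ℕ => (j : ℂ) * a j * w ^ j := by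
    refine (summable_nat_add_iff 1).1 ?_
    refine ((summable_of_le_factorial hb w).mul_left w).congr fun j => ?_
    push_cast
    ring
  have h := (hasDerivAt_id w).mul (hasDerivAt_powerSeries ha w)
  refine h.congr_deriv ?_
  have e : id w * ∑' j : ℕ, ((j : ℂ) + 1) * a (j + 1) * w ^ j = ∑' j : ℕ, (j : ℂ) * a j * w ^ j := by
    rw [hs1.tsum_eq_zero_add, ← tsum_mul_left]
    simp only [Nat.cast_zero, zero_mul, zero_add, id]
    refine tsum_congr fun j => ?_
    push_cast
    ring
  rw [e, one_mul, ← hs.tsum_add hs1]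
  refine tsum_congr fun j => ?_
  ring

theorem hasDerivAt_mul_jSeries_one (w : ℂ) :
    HasDerivAt (fun w => w * jSeries 1 w) (jSeries 0 w) w := by
  refine (hasDerivAt_mul_powerSeries (norm_jCoeff_le 1) w).congr_deriv ?_
  refine tsum_congr fun j => ?_
  have h3 : (j : ℂ) + 1 ≠ 0 := Nat.cast_add_one_ne_zero j
  rw [jCoeff, jCoeff, factorial_cast_succ j, add_zero]
  field_simp

theorem hasDerivAt_mul_ySeries_one (w : ℂ) :
    HasDerivAt (fun w => w * ySeries 1 w) (ySeries 0 w + jSeries 1 w) w := by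
  refine (hasDerivAt_mul_powerSeries (norm_yCoeff_le 1) w).congr_deriv ?_
  rw [ySeries, jSeries, ← (summable_of_le_factorial (norm_yCoeff_le 0) w).tsum_add
    (summable_of_le_factorial (norm_jCoeff_le 1) w)]
  refine tsum_congr fun j => ?_
  have h3 : (j : ℂ) + 1 ≠ 0 := Nat.cast_add_one_ne_zero j
  have h1 : (j ! : ℂ) ≠ 0 := Nat.cast_ne_zero.2 (Nat.factorial_ne_zero _)
  rw [yCoeff, yCoeff, jCoeff, factorial_cast_succ j, add_zero, digammaSucc_succ j]
  push_cast
  field_simp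
  ring

/-! ### Recurrences and Bessel's equation for cylinder families. -/

/-- The complement of the branch cut of `logUp`. -/
def logUpDomain : Set ℂ := {z | -I * z ∈ slitPlane}

theorem isOpen_logUpDomain : IsOpen logUpDomain :=
  isOpen_slitPlane.preimage (continuous_const.mul continuous_id)

theorem ne_zero_of_mem_logUpDomain {z : ℂ} (hz : z ∈ logUpDomain) : z ≠ 0 := by
  rintro rfl
  simp [logUpDomain] at hz

theorem CStarNonneg_subset_logUpDomain : CStarNonneg ⊆ logUpDomain := by
  rintro z ⟨h0, him⟩
  rw [logUpDomain, Set.mem_ofPred_eq, mem_slitPlane_iff]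
  simp only [neg_mul, neg_re, neg_im, mul_re, mul_im, I_re, I_im]
  by_cases h : z.re = 0
  · left
    have : z.im ≠ 0 := fun h' => h0 (Complex.ext h h')
    have : 0 < z.im := lt_of_le_of_ne him (Ne.symm this)
    linarith
  · right
    simpa using h

theorem hasDerivAt_logUp {z : ℂ} (hz : z ∈ logUpDomain) : HasDerivAt logUp (1 / z) z := by
  have h0 := ne_zero_of_mem_logUpDomain hz
  have h := (((hasDerivAt_id z).const_mul (-I)).clog (by simpa [logUpDomain] using hz)).add_const
    (I * (Real.pi / 2))
  refine h.congr_deriv ?_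
  have := I_ne_zero
  simp only [id]
  field_simp

theorem half_mem_logUpDomain {z : ℂ} (hz : z ∈ logUpDomain) : z / 2 ∈ logUpDomain := by
  rw [logUpDomain, Set.mem_ofPred_eq, mem_slitPlane_iff] at *
  have e : -I * (z / 2) = (-I * z) / 2 := by ring
  rw [e, div_ofNat_re, div_ofNat_im]
  rcases hz with h | h
  · left; positivity
  · right; simpa using h

/-- A family of functions satisfying the recurrences which relate the Bessel functions
of consecutive orders. -/
structure IsCylinderFamily (C : ℕ → ℂ → ℂ) : Prop where
  hasDerivAt_lower : ∀ (n : ℕ) (z : ℂ), z ∈ logUpDomain →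
    HasDerivAt (C n) (n / z * C n z - C (n + 1) z) z
  hasDerivAt_one : ∀ z : ℂ, z ∈ logUpDomain → HasDerivAt (C 1) (C 0 z - C 1 z / z) z

namespace IsCylinderFamily

variable {C : ℕ → ℂ → ℂ}

/-- Equating the two formulas for `C_{n+1}'` gives the three-term recurrence; differentiating that
recurrence yields the formula for the next order. The field `hasDerivAt_one` starts the induction.
-/
theorem hasDerivAt_upper (h : IsCylinderFamily C) (n : ℕ) : ∀ z : ℂ, z ∈ logUpDomain →
    HasDerivAt (C (n + 1)) (C n z - (n + 1) / z * C (n + 1) z) z := by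
  induction n with
  | zero =>
    intro z hz
    refine (h.hasDerivAt_one z hz).congr_deriv ?_
    simp
    ring
  | succ n ih =>
    intro z hz
    have key : ∀ w ∈ logUpDomain, C (n + 2) w = 2 * (n + 1) / w * C (n + 1) w - C n w := by
      intro w hw
      have := (h.hasDerivAt_lower (n + 1) w hw).unique (ih w hw)
      push_cast at this
      linear_combination -this
    have h0 := ne_zero_of_mem_logUpDomain hz
    have hd : HasDerivAt (fun w => 2 * (n + 1) / w * C (n + 1) w - C n w)
        (-(2 * (n + 1) / z ^ 2) * C (n + 1) z +
          2 * (n + 1) / z * (C n z - (n + 1) / z * C (n + 1) z) -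
          (n / z * C n z - C (n + 1) z)) z := by
      have h1 : HasDerivAt (fun w : ℂ => 2 * ((n : ℂ) + 1) / w) (-(2 * (n + 1) / z ^ 2)) z := by
        refine ((hasDerivAt_inv h0).const_mul (2 * ((n : ℂ) + 1))).congr_deriv ?_
        ring
      exact (h1.mul (ih z hz)).sub (h.hasDerivAt_lower n z hz)
    have he : C (n + 2) =ᶠ[nhds z] fun w => 2 * (n + 1) / w * C (n + 1) w - C n w :=
      Filter.eventually_of_mem (isOpen_logUpDomain.mem_nhds hz) key
    refine (hd.congr_of_eventuallyEq he).congr_deriv ?_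
    rw [key z hz]
    push_cast
    field_simp
    ring

theorem three_term (h : IsCylinderFamily C) (n : ℕ) {z : ℂ} (hz : z ∈ logUpDomain) :
    C (n + 2) z = 2 * (n + 1) / z * C (n + 1) z - C n z := by
  have := (h.hasDerivAt_lower (n + 1) z hz).unique (h.hasDerivAt_upper n z hz)
  push_cast at this
  linear_combination -this

/-- The function `n C_n - z C_{n+1}` equals `z C_n'`; this is Bessel's equation for `C_n`. -/
theorem hasDerivAt_bessel (h : IsCylinderFamily C) (n : ℕ) {z : ℂ} (hz : z ∈ logUpDomain) :
    HasDerivAt (fun z => n * C n z - z * C (n + 1) z) ((n ^ 2 / z - z) * C n z) z := by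
  have h0 := ne_zero_of_mem_logUpDomain hz
  refine (((h.hasDerivAt_lower n z hz).const_mul (n : ℂ)).sub
    ((hasDerivAt_id z).mul (h.hasDerivAt_upper n z hz))).congr_deriv ?_
  simp only [id]
  field_simp
  ring

theorem add_const_mul {C' : ℕ → ℂ → ℂ} (h : IsCylinderFamily C) (h' : IsCylinderFamily C')
    (c : ℂ) : IsCylinderFamily fun n z => C n z + c * C' n z where
  hasDerivAt_lower n z hz := by
    refine ((h.hasDerivAt_lower n z hz).add
      ((h'.hasDerivAt_lower n z hz).const_mul c)).congr_deriv ?_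
    ring
  hasDerivAt_one z hz := by
    refine ((h.hasDerivAt_one z hz).add ((h'.hasDerivAt_one z hz).const_mul c)).congr_deriv ?_
    ring

end IsCylinderFamily

/-! ### `J_n`, `Y_n` and `H_n` are cylinder families. -/

theorem besselJNat_eq (n : ℕ) (z : ℂ) :
    besselJNat n z = (z / 2) ^ n * jSeries n ((z / 2) ^ 2) := by
  rw [besselJNat, jSeries, ← tsum_mul_left]
  refine tsum_congr fun j => ?_
  rw [jCoeff, pow_add, pow_mul]
  ring

/-- The polynomial in `(z/2)^2` in the definition of `Y_n`. -/
def yPoly (n : ℕ) (w : ℂ) : ℂ := ∑ j ∈ Finset.range n, (((n - 1 - j)! : ℂ) / (j ! : ℂ)) * w ^ j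

theorem besselYNat_eq (n : ℕ) (z : ℂ) :
    besselYNat n z = (2 / Real.pi : ℂ) * logUp (z / 2) * ((z / 2) ^ n * jSeries n ((z / 2) ^ 2))
      - (1 / Real.pi : ℂ) * (yPoly n ((z / 2) ^ 2) / (z / 2) ^ n)
      - (1 / Real.pi : ℂ) * ((z / 2) ^ n * ySeries n ((z / 2) ^ 2)) := by
  have e1 : ∑ j ∈ Finset.range n, (((n - 1 - j)! : ℂ) / (j ! : ℂ)) *
      ((z / 2) ^ (2 * j) / (z / 2) ^ n) = yPoly n ((z / 2) ^ 2) / (z / 2) ^ n := by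
    rw [yPoly, Finset.sum_div]
    refine Finset.sum_congr rfl fun j _ => ?_
    rw [pow_mul]
    ring
  rw [besselYNat, besselJNat_eq, e1, ySeries, ← tsum_mul_left (a := (z / 2) ^ n)]
  congr 2
  refine tsum_congr fun j => ?_
  rw [yCoeff, pow_add, pow_mul]
  ring

/-- The derivative of `yPoly n`, multiplied by `w`. -/
theorem hasDerivAt_yPoly (n : ℕ) {w : ℂ} (hw : w ≠ 0) :
    HasDerivAt (yPoly n) ((n * yPoly n w - yPoly (n + 1) w + w ^ n / (n ! : ℂ)) / w) w := by
  have h : HasDerivAt (yPoly n) (∑ j ∈ Finset.range n,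
      (((n - 1 - j)! : ℂ) / (j ! : ℂ)) * (j * w ^ (j - 1))) w := by
    unfold yPoly
    refine HasDerivAt.fun_sum fun j _ => ?_
    exact (hasDerivAt_pow j w).const_mul _
  refine h.congr_deriv ?_
  rw [eq_div_iff hw, yPoly, yPoly, Finset.sum_range_succ, Finset.sum_mul, Finset.mul_sum]
  simp only [Nat.add_sub_cancel, Nat.sub_self, Nat.factorial_zero, Nat.cast_one]
  rw [← sub_sub, ← Finset.sum_sub_distrib, one_div, inv_mul_eq_div, sub_add_cancel]
  refine Finset.sum_congr rfl fun j hj => ?_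
  have hj' := Finset.mem_range.1 hj
  obtain ⟨d, rfl⟩ : ∃ d, n = j + d + 1 := ⟨n - j - 1, by omega⟩
  have a1 : j + d + 1 - 1 - j = d := by omega
  have a2 : j + d + 1 - j = d + 1 := by omega
  have a3 : (j : ℂ) * w ^ (j - 1) * w = j * w ^ j := by
    cases j with
    | zero => simp
    | succ j => rw [Nat.add_sub_cancel]; ring
  rw [a1, a2, factorial_cast_succ, mul_assoc, a3]
  push_cast
  ring

theorem isCylinderFamily_besselJNat : IsCylinderFamily besselJNat where
  hasDerivAt_lower n z hz := by
    have h0 := ne_zero_of_mem_logUpDomain hz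
    have hs : HasDerivAt (fun z : ℂ => z / 2) (1 / 2) z := (hasDerivAt_id z).div_const 2
    have hf := (hasDerivAt_jSeries n ((z / 2) ^ 2)).comp z (hs.fun_pow 2)
    have h := (hs.fun_pow n).mul hf
    have he : besselJNat n = fun z => (z / 2) ^ n * jSeries n ((z / 2) ^ 2) :=
      funext (besselJNat_eq n)
    rw [he, besselJNat_eq (n + 1)]
    refine h.congr_deriv ?_
    cases n with
    | zero => simp; ring
    | succ n =>
      simp only [Nat.add_sub_cancel, Function.comp]
      push_cast
      field_simp
      ring
  hasDerivAt_one z hz := by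
    have h0 := ne_zero_of_mem_logUpDomain hz
    have hs : HasDerivAt (fun z : ℂ => z / 2) (1 / 2) z := (hasDerivAt_id z).div_const 2
    have hf := (hasDerivAt_mul_jSeries_one ((z / 2) ^ 2)).comp z (hs.fun_pow 2)
    have h := hf.mul ((hasDerivAt_inv h0).const_mul 2)
    -- Written as `w f(w) · (2 / z)` with `w = (z/2)²`, so that `hasDerivAt_mul_jSeries_one`
    -- applies.
    have he : besselJNat 1 =ᶠ[nhds z] fun z =>
        (z / 2) ^ 2 * jSeries 1 ((z / 2) ^ 2) * (2 * z⁻¹) := by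
      filter_upwards [isOpen_logUpDomain.mem_nhds hz] with w hw
      have hw0 := ne_zero_of_mem_logUpDomain hw
      rw [besselJNat_eq]
      field_simp
    refine (h.congr_of_eventuallyEq he).congr_deriv ?_
    rw [besselJNat_eq, besselJNat_eq]
    simp only [Function.comp]
    field_simp
    ring

theorem isCylinderFamily_besselYNat : IsCylinderFamily besselYNat where
  hasDerivAt_lower n z hz := by
    have h0 := ne_zero_of_mem_logUpDomain hz
    have hs : HasDerivAt (fun z : ℂ => z / 2) (1 / 2) z := (hasDerivAt_id z).div_const 2
    have hs0 : z / 2 ≠ 0 := div_ne_zero h0 two_ne_zero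
    have hw0 : (z / 2) ^ 2 ≠ 0 := pow_ne_zero _ hs0
    have hl := (hasDerivAt_logUp (half_mem_logUpDomain hz)).comp z hs
    have hf := (hasDerivAt_jSeries n ((z / 2) ^ 2)).comp z (hs.fun_pow 2)
    have hg := (hasDerivAt_ySeries n hw0).comp z (hs.fun_pow 2)
    have hp := (hasDerivAt_yPoly n hw0).comp z (hs.fun_pow 2)
    have hpow : HasDerivAt (fun z : ℂ => (z / 2) ^ n) (n * (z / 2) ^ n / z) z := by
      refine (hs.fun_pow n).congr_deriv ?_
      cases n with
      | zero => simp
      | succ n =>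
        simp only [Nat.add_sub_cancel]
        field_simp
        ring
    have hπ : (Real.pi : ℂ) ≠ 0 := by exact_mod_cast Real.pi_ne_zero
    have h := (((hl.const_mul (2 / Real.pi : ℂ)).mul (hpow.mul hf)).sub
      ((hp.div hpow (pow_ne_zero n hs0)).const_mul (1 / Real.pi : ℂ))).sub
      ((hpow.mul hg).const_mul (1 / Real.pi : ℂ))
    rw [funext (besselYNat_eq n), besselYNat_eq (n + 1)]
    refine h.congr_deriv ?_
    have hn : (n ! : ℂ) ≠ 0 := Nat.cast_ne_zero.2 (Nat.factorial_ne_zero _)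
    simp only [Function.comp, Pi.mul_apply]
    have hz2 : z = 2 * (z / 2) := by ring
    generalize z / 2 = s at *
    subst hz2
    field_simp
    ring
  hasDerivAt_one z hz := by
    have h0 := ne_zero_of_mem_logUpDomain hz
    have hs : HasDerivAt (fun z : ℂ => z / 2) (1 / 2) z := (hasDerivAt_id z).div_const 2
    have hl := (hasDerivAt_logUp (half_mem_logUpDomain hz)).comp z hs
    have hf := (hasDerivAt_mul_jSeries_one ((z / 2) ^ 2)).comp z (hs.fun_pow 2)
    have hg := (hasDerivAt_mul_ySeries_one ((z / 2) ^ 2)).comp z (hs.fun_pow 2)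
    have hπ : (Real.pi : ℂ) ≠ 0 := by exact_mod_cast Real.pi_ne_zero
    have h := ((((hl.const_mul (2 / Real.pi : ℂ)).mul hf).sub_const (1 / Real.pi : ℂ)).sub
      (hg.const_mul (1 / Real.pi : ℂ))).mul ((hasDerivAt_inv h0).const_mul 2)
    have he : besselYNat 1 =ᶠ[nhds z] fun z => ((2 / Real.pi : ℂ) * logUp (z / 2) *
        ((z / 2) ^ 2 * jSeries 1 ((z / 2) ^ 2)) - (1 / Real.pi : ℂ) -
        (1 / Real.pi : ℂ) * ((z / 2) ^ 2 * ySeries 1 ((z / 2) ^ 2))) * (2 * z⁻¹) := by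
      filter_upwards [isOpen_logUpDomain.mem_nhds hz] with w hw
      have hw0 := ne_zero_of_mem_logUpDomain hw
      rw [besselYNat_eq]
      simp [yPoly]
      field_simp
    refine (h.congr_of_eventuallyEq he).congr_deriv ?_
    rw [besselYNat_eq, besselYNat_eq]
    simp [yPoly]
    field_simp
    ring

/-- The Hankel function of natural order. -/
def hankelNat (n : ℕ) (z : ℂ) : ℂ := besselJNat n z + I * besselYNat n z

theorem isCylinderFamily_hankelNat : IsCylinderFamily hankelNat :=
  isCylinderFamily_besselJNat.add_const_mul isCylinderFamily_besselYNat I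

/-! ### Size and sign of the series for `K_0`. -/

theorem digammaSucc_le_log (j : ℕ) : digammaSucc j ≤ Real.log (j + 1) := by
  have h := Real.eulerMascheroniSeq_lt_eulerMascheroniConstant j
  rw [Real.eulerMascheroniSeq] at h
  rw [digammaSucc]
  linarith

theorem log_sub_le_digammaSucc (j : ℕ) : Real.log (j + 1) - 1 / (j + 1) ≤ digammaSucc j := by
  have h := Real.eulerMascheroniConstant_lt_eulerMascheroniSeq' (j + 1)
  rw [Real.eulerMascheroniSeq', if_neg (Nat.succ_ne_zero j), harmonic_succ] at h
  push_cast at h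
  rw [digammaSucc, one_div]
  linarith

/-- The terms of the power series of the modified Bessel function `I_0(2y)`. -/
def iTerm (y : ℝ) (j : ℕ) : ℝ := y ^ (2 * j) / ((j ! : ℝ) * j !)

theorem iTerm_nonneg (y : ℝ) (j : ℕ) : 0 ≤ iTerm y j := by
  rw [iTerm, pow_mul]
  positivity

theorem iTerm_succ (y : ℝ) (j : ℕ) : iTerm y (j + 1) = (y / (j + 1)) ^ 2 * iTerm y j := by
  rw [iTerm, iTerm, Nat.factorial_succ]
  push_cast
  field_simp
  ring

theorem summable_iTerm (y : ℝ) : Summable (iTerm y) := by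
  refine Summable.of_nonneg_of_le (iTerm_nonneg y) (fun j => ?_)
    (Real.summable_pow_div_factorial (y ^ 2))
  rw [iTerm, ← pow_mul]
  have h1 : (1 : ℝ) ≤ (j ! : ℝ) := by exact_mod_cast Nat.one_le_iff_ne_zero.mpr (by positivity)
  have h2 : 0 ≤ y ^ (2 * j) := by rw [pow_mul]; positivity
  gcongr
  nlinarith

theorem one_add_sq_le_tsum_iTerm (y : ℝ) : 1 + y ^ 2 ≤ ∑' j, iTerm y j := by
  have h := (summable_iTerm y).sum_le_tsum (Finset.range 2) fun j _ => iTerm_nonneg y j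
  refine le_trans (le_of_eq ?_) h
  simp [Finset.sum_range_succ, iTerm]

/-- An exact second moment: under the weights `iTerm y`, the mean of `j²` is `y²`. This makes the
main term of the upper bound for `ψ(j + 1) - log y` average to zero. -/
theorem hasSum_sq_mul_iTerm (y : ℝ) :
    HasSum (fun j : ℕ => (j : ℝ) ^ 2 * iTerm y j) (y ^ 2 * ∑' j, iTerm y j) := by
  have h : HasSum (fun j : ℕ => ((j + 1 : ℕ) : ℝ) ^ 2 * iTerm y (j + 1))
      (y ^ 2 * ∑' j, iTerm y j) := by
    refine ((summable_iTerm y).hasSum.mul_left (y ^ 2)).congr_fun fun j => ?_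
    rw [iTerm_succ]
    push_cast
    field_simp
  have := (hasSum_nat_add_iff (f := fun j : ℕ => (j : ℝ) ^ 2 * iTerm y j) 1).1 h
  simpa using this

theorem hasSum_div_sq_mul_iTerm (y : ℝ) :
    HasSum (fun j : ℕ => (y / (j + 1)) ^ 2 * iTerm y j) (∑' j, iTerm y j - 1) := by
  simp only [← iTerm_succ]
  have := (hasSum_nat_add_iff' 1).2 (summable_iTerm y).hasSum
  simpa [iTerm] using this

/-- From `log t ≤ t - 1` and `t ≤ (t² + 1) / 2`; squares appear because their weighted sums are
known in closed form. -/
theorem digammaSucc_sub_log_le {y : ℝ} (hy : 0 < y) (j : ℕ) :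
    digammaSucc j - Real.log y ≤ (j ^ 2 / y ^ 2 - 1) / 2 + 1 / y := by
  have h1 : Real.log ((j + 1) / y) ≤ (j + 1) / y - 1 :=
    Real.log_le_sub_one_of_pos (by positivity)
  rw [Real.log_div (by positivity) hy.ne'] at h1
  have h2 := digammaSucc_le_log j
  have h3 : (j : ℝ) / y ≤ (j ^ 2 / y ^ 2 + 1) / 2 := by
    have := sq_nonneg ((j : ℝ) / y - 1)
    rw [← div_pow]
    linarith
  rw [add_div] at h1
  linarith

theorem log_sub_digammaSucc_le {y : ℝ} (hy : 0 < y) (j : ℕ) :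
    Real.log y - digammaSucc j ≤
      ((y / (j + 1)) ^ 2 - 1) / 2 + ((y / (j + 1)) ^ 2 + 1) / 2 * (1 / y) := by
  have h1 : Real.log (y / (j + 1)) ≤ y / (j + 1) - 1 :=
    Real.log_le_sub_one_of_pos (by positivity)
  rw [Real.log_div hy.ne' (by positivity)] at h1
  have h2 := log_sub_le_digammaSucc j
  have h3 : y / (j + 1) ≤ ((y / (j + 1)) ^ 2 + 1) / 2 := by
    have := sq_nonneg (y / (j + 1) - 1)
    linarith
  have h4 : (1 : ℝ) / (j + 1) = y / (j + 1) * (1 / y) := by field_simp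
  have h5 : y / (j + 1) * (1 / y) ≤ ((y / (j + 1)) ^ 2 + 1) / 2 * (1 / y) := by gcongr
  linarith

theorem summable_digammaSucc_mul_iTerm (y : ℝ) : Summable fun j => digammaSucc j * iTerm y j := by
  refine Summable.of_norm_bounded (g := fun j : ℕ => (j : ℝ) ^ 2 * iTerm y j + 2 * iTerm y j)
    ((hasSum_sq_mul_iTerm y).summable.add ((summable_iTerm y).mul_left 2)) fun j => ?_
  rw [norm_mul, Real.norm_eq_abs, Real.norm_of_nonneg (iTerm_nonneg y j), ← add_mul]
  gcongr
  · exact iTerm_nonneg y j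
  · have := abs_digammaSucc_le j
    nlinarith [sq_nonneg ((j : ℝ) - 1)]

theorem hasSum_digammaSucc_sub_log (y : ℝ) :
    HasSum (fun j => (digammaSucc j - Real.log y) * iTerm y j)
      (∑' j, digammaSucc j * iTerm y j - Real.log y * ∑' j, iTerm y j) := by
  simp only [sub_mul]
  exact (summable_digammaSucc_mul_iTerm y).hasSum.sub ((summable_iTerm y).hasSum.mul_left _)

/-- With respect to the weights `iTerm y`, the mean of `ψ(j + 1)` is close to `log y`. -/
theorem abs_tsum_digammaSucc_sub_log_le {y : ℝ} (hy : 0 < y) :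
    |∑' j, digammaSucc j * iTerm y j - Real.log y * ∑' j, iTerm y j| ≤
      1 / y * ∑' j, iTerm y j := by
  have hI := (summable_iTerm y).hasSum
  have h := hasSum_digammaSucc_sub_log y
  rw [abs_le]
  constructor
  · have hU : HasSum (fun j : ℕ => (((y / (j + 1)) ^ 2 - 1) / 2 +
        ((y / (j + 1)) ^ 2 + 1) / 2 * (1 / y)) * iTerm y j)
        ((1 / 2 + 1 / 2 * (1 / y)) * (∑' j, iTerm y j - 1) +
          (-1 / 2 + 1 / 2 * (1 / y)) * ∑' j, iTerm y j) := by
      refine (((hasSum_div_sq_mul_iTerm y).mul_left _).add (hI.mul_left _)).congr_fun ?_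
      intro j
      ring
    have := hasSum_le (fun j => ?_) h.neg hU
    · have h2 : 0 ≤ 1 / 2 + 1 / 2 * (1 / y) := by positivity
      linarith
    · rw [← neg_mul, neg_sub]
      exact mul_le_mul_of_nonneg_right (log_sub_digammaSucc_le hy j) (iTerm_nonneg y j)
  · have hU : HasSum (fun j : ℕ => ((j ^ 2 / y ^ 2 - 1) / 2 + 1 / y) * iTerm y j)
        (1 / (2 * y ^ 2) * (y ^ 2 * ∑' j, iTerm y j) + (-1 / 2 + 1 / y) * ∑' j, iTerm y j) := by
      refine (((hasSum_sq_mul_iTerm y).mul_left _).add (hI.mul_left _)).congr_fun ?_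
      intro j
      field_simp
      ring
    have := hasSum_le (fun j => ?_) h hU
    · refine this.trans (le_of_eq ?_)
      field_simp
      ring
    · exact mul_le_mul_of_nonneg_right (digammaSucc_sub_log_le hy j) (iTerm_nonneg y j)

/-- Every term is positive, since `ψ(j + 1) ≥ -γ > -1`. This fixes the sign of `K_0` at one point.
-/
theorem tsum_digammaSucc_sub_log_pos {y : ℝ} (hy : Real.log y = -1) :
    0 < ∑' j, digammaSucc j * iTerm y j - Real.log y * ∑' j, iTerm y j := by
  have h := hasSum_digammaSucc_sub_log y
  have hd : ∀ j, 0 < digammaSucc j - Real.log y := by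
    intro j
    have h1 := Real.eulerMascheroniConstant_lt_two_thirds
    have h2 : (0 : ℝ) ≤ (harmonic j : ℝ) := by
      have : (0 : ℚ) ≤ harmonic j := by unfold harmonic; positivity
      exact_mod_cast this
    rw [digammaSucc, hy]
    linarith
  rw [← h.tsum_eq]
  refine h.summable.tsum_pos (fun j => mul_nonneg (hd j).le (iTerm_nonneg y j)) 0 ?_
  exact mul_pos (hd 0) (by simp [iTerm])

/-! ### Positivity of `K_0` and `K_1`. -/

open Filter Topology in
/-- A solution of the modified Bessel equation which is small compared to the growing solution
and somewhere positive is positive and decreasing. -/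
theorem modified_bessel_pos {I₀ I₁ K₀ K₁ : ℝ → ℝ}
    (hI₀ : ∀ x, 0 < x → HasDerivAt I₀ (I₁ x) x)
    (hI₁ : ∀ x, 0 < x → HasDerivAt I₁ (I₀ x - I₁ x / x) x)
    (hK₀ : ∀ x, 0 < x → HasDerivAt K₀ (-K₁ x) x)
    (hK₁ : ∀ x, 0 < x → HasDerivAt K₁ (-K₀ x - K₁ x / x) x)
    (hIx : ∀ x, 0 < x → 1 + (x / 2) ^ 2 ≤ I₀ x)
    (hI₁pos : ∀ x, 0 < x → 0 < I₁ x)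
    (hK : ∀ x, 0 < x → |K₀ x| ≤ 2 / x * I₀ x)
    (hpos : ∃ x, 0 < x ∧ 0 < K₀ x) :
    ∀ x, 0 < x → 0 < K₀ x ∧ 0 < K₁ x := by
  have hIp : ∀ x, 0 < x → 0 < I₀ x := fun x hx => lt_of_lt_of_le (by positivity) (hIx x hx)
  have hxI₁ : ∀ x, 0 < x → HasDerivAt (fun x => x * I₁ x) (x * I₀ x) x := by
    intro x hx
    refine ((hasDerivAt_id x).mul (hI₁ x hx)).congr_deriv ?_
    simp only [id]
    field_simp
    ring
  have hxK₁ : ∀ x, 0 < x → HasDerivAt (fun x => x * K₁ x) (-(x * K₀ x)) x := by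
    intro x hx
    refine ((hasDerivAt_id x).mul (hK₁ x hx)).congr_deriv ?_
    simp only [id]
    field_simp
    ring
  -- The Wronskian of `I₀` and `K₀`, times `x`, is constant; its sign decides the monotonicity of
  -- `K₀ / I₀`.
  obtain ⟨c, hc⟩ : ∃ c, ∀ x, 0 < x → x * K₁ x * I₀ x + x * I₁ x * K₀ x = c := by
    have hW : ∀ x, 0 < x → HasDerivAt (fun x => x * K₁ x * I₀ x + x * I₁ x * K₀ x) 0 x := by
      intro x hx
      refine (((hxK₁ x hx).mul (hI₀ x hx)).add ((hxI₁ x hx).mul (hK₀ x hx))).congr_deriv ?_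
      ring
    refine ⟨_, fun x hx => isOpen_Ioi.is_const_of_deriv_eq_zero (convex_Ioi (0 : ℝ)).isPreconnected
      (fun x hx => (hW x hx).differentiableAt.differentiableWithinAt)
      (fun x hx => (hW x hx).deriv) hx (Set.mem_Ioi.2 one_pos)⟩
  have hq : ∀ x, 0 < x → HasDerivAt (fun x => K₀ x / I₀ x) (-c / (x * I₀ x ^ 2)) x := by
    intro x hx
    refine ((hK₀ x hx).div (hI₀ x hx) (hIp x hx).ne').congr_deriv ?_
    rw [← hc x hx]
    have := (hIp x hx).ne'
    field_simp
    ring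
  have hqlim : Tendsto (fun x => K₀ x / I₀ x) atTop (𝓝 0) := by
    refine squeeze_zero_norm' (a := fun x => 2 / x) ?_ (tendsto_const_nhds.div_atTop tendsto_id)
    filter_upwards [eventually_gt_atTop 0] with x hx
    rw [norm_div, Real.norm_eq_abs, Real.norm_of_nonneg (hIp x hx).le, div_le_iff₀ (hIp x hx)]
    exact hK x hx
  -- If `c ≤ 0`, the quotient `K₀ / I₀` is nondecreasing with limit 0, hence never positive, against
  -- `hpos`.
  have hc0 : 0 < c := by
    by_contra! hc0
    obtain ⟨x₀, hx₀, hKx₀⟩ := hpos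
    have hm : MonotoneOn (fun x => K₀ x / I₀ x) (Set.Ioi 0) := by
      refine monotoneOn_of_deriv_nonneg (convex_Ioi 0)
        (fun x hx => (hq x hx).continuousAt.continuousWithinAt) ?_ ?_
      · rw [interior_Ioi]
        exact fun x hx => (hq x hx).differentiableAt.differentiableWithinAt
      · rw [interior_Ioi]
        intro x hx
        rw [(hq x hx).deriv]
        have : 0 < x := hx
        exact div_nonneg (by linarith) (by positivity)
    have : K₀ x₀ / I₀ x₀ ≤ 0 := by
      refine ge_of_tendsto hqlim ?_
      filter_upwards [eventually_ge_atTop x₀] with x hx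
      exact hm hx₀ (hx₀.trans_le hx) hx
    have := div_pos hKx₀ (hIp x₀ hx₀)
    linarith
  have hK₀pos : ∀ x, 0 < x → 0 < K₀ x := by
    intro x hx
    have hm : StrictAntiOn (fun x => K₀ x / I₀ x) (Set.Ioi 0) := by
      refine strictAntiOn_of_deriv_neg (convex_Ioi 0)
        (fun x hx => (hq x hx).continuousAt.continuousWithinAt) ?_
      rw [interior_Ioi]
      intro x hx
      rw [(hq x hx).deriv]
      have h1 : 0 < x := hx
      have h2 := hIp x hx
      exact div_neg_of_neg_of_pos (by linarith) (by positivity)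
    have h1 : 0 ≤ K₀ (x + 1) / I₀ (x + 1) := by
      refine le_of_tendsto hqlim ?_
      filter_upwards [eventually_ge_atTop (x + 1)] with t ht
      exact hm.antitoneOn (by simp; linarith) (by simp; linarith) ht
    have h2 : K₀ (x + 1) / I₀ (x + 1) < K₀ x / I₀ x :=
      hm hx (by simp; linarith) (by linarith)
    have h3 := mul_pos (h1.trans_lt h2) (hIp x hx)
    rwa [div_mul_cancel₀ _ (hIp x hx).ne'] at h3
  have hxI₁mono : StrictMonoOn (fun x => x * I₁ x) (Set.Ioi 0) := by
    refine strictMonoOn_of_deriv_pos (convex_Ioi 0)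
      (fun x hx => (hxI₁ x hx).continuousAt.continuousWithinAt) ?_
    rw [interior_Ioi]
    intro x hx
    rw [(hxI₁ x hx).deriv]
    exact mul_pos hx (hIp x hx)
  have hxK₁anti : StrictAntiOn (fun x => x * K₁ x) (Set.Ioi 0) := by
    refine strictAntiOn_of_deriv_neg (convex_Ioi 0)
      (fun x hx => (hxK₁ x hx).continuousAt.continuousWithinAt) ?_
    rw [interior_Ioi]
    intro x hx
    rw [(hxK₁ x hx).deriv]
    exact neg_neg_of_pos (mul_pos hx (hK₀pos x hx))
  have hK₁nonneg : ∀ x, 0 < x → 0 ≤ K₁ x := by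
    intro x hx
    have hxI := mul_pos hx (hI₁pos x hx)
    -- The claim `0 ≤ K₁ x` is equivalent to `K₀ x ≤ d`, by the Wronskian. With this `d` the
    -- derivative of `(K₀ - d) / I₀` vanishes at `x` and is nonnegative beyond it, and the function
    -- tends to 0.
    set d := c / (x * I₁ x) with hd
    have hR : ∀ t, 0 < t → HasDerivAt (fun t => K₀ t / I₀ t - d / I₀ t)
        ((d * (t * I₁ t) - c) / (t * I₀ t ^ 2)) t := by
      intro t ht
      have hne := (hIp t ht).ne'
      refine ((hq t ht).sub ((hasDerivAt_const t d).div (hI₀ t ht) hne)).congr_deriv ?_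
      field_simp
      ring
    have hm : MonotoneOn (fun t => K₀ t / I₀ t - d / I₀ t) (Set.Ici x) := by
      refine monotoneOn_of_deriv_nonneg (convex_Ici x)
        (fun t ht => (hR t (hx.trans_le ht)).continuousAt.continuousWithinAt) ?_ ?_
      · rw [interior_Ici]
        exact fun t ht => (hR t (hx.trans ht)).differentiableAt.differentiableWithinAt
      · rw [interior_Ici]
        intro t ht
        have ht0 : 0 < t := hx.trans ht
        rw [(hR t ht0).deriv]
        refine div_nonneg ?_ (by positivity)
        have h1 : x * I₁ x ≤ t * I₁ t := (hxI₁mono hx ht0 ht).le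
        have h2 : d * (x * I₁ x) = c := div_mul_cancel₀ _ hxI.ne'
        have h3 : 0 < d := div_pos hc0 hxI
        nlinarith
    have hI₀top : Tendsto I₀ atTop atTop := by
      refine tendsto_atTop_mono' _ ?_ tendsto_id
      filter_upwards [eventually_gt_atTop 0] with t ht
      have := hIx t ht
      simp only [id]
      nlinarith [sq_nonneg (t / 2 - 1)]
    have hlim : Tendsto (fun t => K₀ t / I₀ t - d / I₀ t) atTop (𝓝 0) := by
      simpa using hqlim.sub (tendsto_const_nhds.div_atTop hI₀top)
    have h0 : K₀ x / I₀ x - d / I₀ x ≤ 0 := by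
      refine ge_of_tendsto hlim ?_
      filter_upwards [eventually_ge_atTop x] with t ht
      exact hm (Set.mem_Ici.2 le_rfl) ht ht
    rw [← sub_div, div_le_iff₀ (hIp x hx), zero_mul, sub_nonpos, hd, le_div_iff₀ hxI] at h0
    have h1 := hc x hx
    have h2 : 0 ≤ (x * I₀ x) * K₁ x := by linarith
    exact nonneg_of_mul_nonneg_right h2 (mul_pos hx (hIp x hx))
  intro x hx
  refine ⟨hK₀pos x hx, ?_⟩
  -- Strict decrease of `x K₁` upgrades `0 ≤ K₁` to `0 < K₁`.
  have h1 : (x + 1) * K₁ (x + 1) < x * K₁ x := hxK₁anti hx (by simp; linarith) (by linarith)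
  have h2 := hK₁nonneg (x + 1) (by linarith)
  have h3 : 0 < x * K₁ x := lt_of_le_of_lt (by positivity) h1
  exact pos_of_mul_pos_right h3 hx.le

/-! ### Hankel functions on the positive imaginary axis. -/

theorem HasDerivAt.re_mul_comp_I_mul {f : ℂ → ℂ} {f' : ℂ} {x : ℝ} (c : ℂ)
    (h : HasDerivAt f f' (I * x)) :
    HasDerivAt (fun x : ℝ => (c * f (I * x)).re) (c * (f' * I)).re x := by
  have h1 : HasDerivAt (fun z : ℂ => I * z) I (x : ℂ) := by
    simpa using (hasDerivAt_id (x : ℂ)).const_mul I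
  exact ((HasDerivAt.comp (x : ℂ) h h1).const_mul c).real_of_complex

theorem I_mul_mem_CStarNonneg {x : ℝ} (hx : 0 < x) : I * x ∈ CStarNonneg :=
  ⟨mul_ne_zero I_ne_zero (by exact_mod_cast hx.ne'), by simpa using hx.le⟩

theorem besselJNat_zero_I_mul (x : ℝ) :
    besselJNat 0 (I * x) = (∑' j, iTerm (x / 2) j : ℝ) := by
  rw [besselJNat_eq, jSeries, pow_zero, one_mul, ofReal_tsum]
  refine tsum_congr fun j => ?_
  have e : (I * (x : ℂ) / 2) ^ 2 = -1 * ((x : ℂ) / 2) ^ 2 := by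
    rw [mul_div_assoc, mul_pow, I_sq]
  rw [jCoeff, iTerm, e, mul_pow, ← pow_mul]
  push_cast
  have h : ((-1 : ℂ) ^ j) * (-1) ^ j = 1 := by rw [← mul_pow]; simp
  rw [add_zero]
  linear_combination ((x : ℂ) / 2) ^ (2 * j) / ((j ! : ℂ) * j !) * h

theorem ySeries_zero_I_mul (x : ℝ) :
    ySeries 0 ((I * x / 2) ^ 2) = 2 * (∑' j, digammaSucc j * iTerm (x / 2) j : ℝ) := by
  rw [ySeries, ofReal_tsum, ← tsum_mul_left]
  refine tsum_congr fun j => ?_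
  have e : (I * (x : ℂ) / 2) ^ 2 = -1 * ((x : ℂ) / 2) ^ 2 := by
    rw [mul_div_assoc, mul_pow, I_sq]
  rw [yCoeff, iTerm, e, mul_pow, ← pow_mul]
  push_cast
  have h : ((-1 : ℂ) ^ j) * (-1) ^ j = 1 := by rw [← mul_pow]; simp
  rw [add_zero]
  linear_combination (2 * digammaSucc j) * ((x : ℂ) / 2) ^ (2 * j) / ((j ! : ℂ) * j !) * h

/-- On the positive imaginary axis `H_0` is `2 / (π i)` times the modified Bessel function `K_0`. -/
theorem hankelNat_zero_I_mul {x : ℝ} (hx : 0 < x) :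
    hankelNat 0 (I * x) = -I * (2 / Real.pi *
      (∑' j, digammaSucc j * iTerm (x / 2) j - Real.log (x / 2) * ∑' j, iTerm (x / 2) j) : ℝ) := by
  have hπ : (Real.pi : ℂ) ≠ 0 := by exact_mod_cast Real.pi_ne_zero
  have hl : logUp (I * x / 2) = (Real.log (x / 2) : ℝ) + I * (Real.pi / 2) := by
    rw [logUp, ofReal_log (by positivity)]
    congr 2
    push_cast
    linear_combination (-(x : ℂ) / 2) * I_sq
  have hJ := besselJNat_zero_I_mul x
  have hJ' := hJ
  rw [besselJNat_eq, pow_zero, one_mul] at hJ'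
  rw [hankelNat, hJ, besselYNat_eq, hl, ySeries_zero_I_mul, hJ']
  simp only [yPoly, Finset.range_zero, Finset.sum_empty, pow_zero, one_mul]
  generalize ∑' j, iTerm (x / 2) j = b
  generalize ∑' j, digammaSucc j * iTerm (x / 2) j = a
  push_cast
  field_simp
  linear_combination (Real.pi : ℂ) * b * I_sq

/-- `Re H_0(ix)` is identically zero, and its derivative is `Im H_1(ix)` because `H_0' = -H_1`. -/
theorem im_hankelNat_one_I_mul {x : ℝ} (hx : 0 < x) : (hankelNat 1 (I * x)).im = 0 := by
  have hmem := CStarNonneg_subset_logUpDomain (I_mul_mem_CStarNonneg hx)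
  have h := (isCylinderFamily_hankelNat.hasDerivAt_lower 0 _ hmem).re_mul_comp_I_mul 1
  have h0 : (fun x : ℝ => (1 * hankelNat 0 (I * x)).re) =ᶠ[nhds x] fun _ => 0 := by
    filter_upwards [lt_mem_nhds hx] with t ht
    rw [hankelNat_zero_I_mul ht, one_mul]
    simp
  have := h.unique ((hasDerivAt_const x (0 : ℝ)).congr_of_eventuallyEq h0)
  simpa using this

theorem hankelNat_zero_one_I_mul {x : ℝ} (hx : 0 < x) :
    (∃ κ : ℝ, 0 < κ ∧ hankelNat 0 (I * x) = (-I) ^ 1 * κ) ∧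
      ∃ κ : ℝ, 0 < κ ∧ hankelNat 1 (I * x) = (-I) ^ 2 * κ := by
  have hmem : ∀ x : ℝ, 0 < x → I * (x : ℂ) ∈ logUpDomain := fun x hx =>
    CStarNonneg_subset_logUpDomain (I_mul_mem_CStarNonneg hx)
  have hK₀ : ∀ x : ℝ, 0 < x → (I * hankelNat 0 (I * x)).re = 2 / Real.pi *
      (∑' j, digammaSucc j * iTerm (x / 2) j - Real.log (x / 2) * ∑' j, iTerm (x / 2) j) := by
    intro x hx
    rw [hankelNat_zero_I_mul hx, ← mul_assoc, mul_neg, I_mul_I, neg_neg, one_mul, ofReal_re]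
  have hI₀ : ∀ x : ℝ, (1 * besselJNat 0 (I * x)).re = ∑' j, iTerm (x / 2) j := by
    intro x
    rw [besselJNat_zero_I_mul, one_mul, ofReal_re]
  have hdI₁ : ∀ x : ℝ, 0 < x → HasDerivAt (fun x : ℝ => (-I * besselJNat 1 (I * x)).re)
      ((1 * besselJNat 0 (I * x)).re - (-I * besselJNat 1 (I * x)).re / x) x := by
    intro x hx
    refine ((isCylinderFamily_besselJNat.hasDerivAt_one _ (hmem x hx)).re_mul_comp_I_mul
      (-I)).congr_deriv ?_
    rw [← div_ofReal_re, ← sub_re]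
    congr 1
    have : (x : ℂ) ≠ 0 := by exact_mod_cast hx.ne'
    have := I_ne_zero
    field_simp
    linear_combination (-(x : ℂ) * besselJNat 0 (I * x)) * I_sq
  have key := modified_bessel_pos
    (I₀ := fun x => (1 * besselJNat 0 (I * x)).re) (I₁ := fun x => (-I * besselJNat 1 (I * x)).re)
    (K₀ := fun x => (I * hankelNat 0 (I * x)).re) (K₁ := fun x => (-1 * hankelNat 1 (I * x)).re)
    ?_ hdI₁ ?_ ?_ ?_ ?_ ?_ ?_ x hx
  · obtain ⟨h0, h1⟩ := key
    refine ⟨⟨_, h0, ?_⟩, ⟨_, h1, ?_⟩⟩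
    · rw [hK₀ x hx, hankelNat_zero_I_mul hx, pow_one]
    · have him := im_hankelNat_one_I_mul hx
      refine Complex.ext ?_ ?_ <;> simp [him, ← ofReal_neg]
  · intro x hx
    refine ((isCylinderFamily_besselJNat.hasDerivAt_lower 0 _
      (hmem x hx)).re_mul_comp_I_mul 1).congr_deriv ?_
    simp
  · intro x hx
    refine ((isCylinderFamily_hankelNat.hasDerivAt_lower 0 _
      (hmem x hx)).re_mul_comp_I_mul I).congr_deriv ?_
    simp
  · intro x hx
    refine ((isCylinderFamily_hankelNat.hasDerivAt_one _
      (hmem x hx)).re_mul_comp_I_mul (-1)).congr_deriv ?_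
    rw [← div_ofReal_re, ← neg_re, ← sub_re]
    congr 1
    have : (x : ℂ) ≠ 0 := by exact_mod_cast hx.ne'
    have := I_ne_zero
    field_simp
    ring
  · intro x hx
    rw [hI₀]
    exact one_add_sq_le_tsum_iTerm _
  · intro x hx
    -- `x I₁` starts at 0 and has derivative `x I₀ > 0`.
    have hm : StrictMonoOn (fun x : ℝ => x * (-I * besselJNat 1 (I * x)).re) (Set.Ici 0) := by
      refine strictMonoOn_of_deriv_pos (convex_Ici 0) ?_ ?_
      · have := (differentiable_besselJNat 1).continuous
        fun_prop
      · rw [interior_Ici]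
        intro t ht
        have ht0 : 0 < t := ht
        have hd := (hasDerivAt_id t).mul (hdI₁ t ht)
        have hd' := hd.deriv
        simp only [id] at hd'
        change 0 < deriv (id * fun x : ℝ => (-I * besselJNat 1 (I * x)).re) t
        rw [hd', hI₀]
        have h1 := one_add_sq_le_tsum_iTerm (t / 2)
        have h2 : 0 < t * ∑' j, iTerm (t / 2) j := by
          refine mul_pos ht0 (lt_of_lt_of_le ?_ h1)
          positivity
        refine lt_of_lt_of_eq h2 ?_
        field_simp
        ring
    have := hm (Set.mem_Ici.2 le_rfl) (Set.mem_Ici.2 hx.le) hx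
    simp only [zero_mul] at this
    exact pos_of_mul_pos_right this hx.le
  · intro x hx
    rw [hI₀, hK₀ x hx, abs_mul, abs_of_pos (by positivity)]
    have h1 := abs_tsum_digammaSucc_sub_log_le (half_pos hx)
    have h2 : 2 / Real.pi ≤ 1 := by
      rw [div_le_one Real.pi_pos]
      exact Real.two_le_pi
    refine (mul_le_of_le_one_left (abs_nonneg _) h2).trans (h1.trans (le_of_eq ?_))
    rw [one_div_div]
  · refine ⟨2 * Real.exp (-1), by positivity, ?_⟩
    rw [hK₀ _ (by positivity)]
    refine mul_pos (by positivity) (tsum_digammaSucc_sub_log_pos ?_)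
    rw [mul_div_cancel_left₀ _ two_ne_zero, Real.log_exp]

/-- On the positive imaginary axis `H_n` is `(2 / π) (-i)^(n+1) K_n` with `K_n` positive. -/
theorem exists_pos_hankelNat_I_mul {x : ℝ} (hx : 0 < x) (n : ℕ) :
    ∃ κ : ℝ, 0 < κ ∧ hankelNat n (I * x) = (-I) ^ (n + 1) * κ := by
  obtain ⟨h0, h1⟩ := hankelNat_zero_one_I_mul hx
  induction n using Nat.twoStepInduction with
  | zero => exact h0
  | one => exact h1
  | more n ih ih' =>
    obtain ⟨a, ha, ha'⟩ := ih
    obtain ⟨b, hb, hb'⟩ := ih'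
    -- With the phases factored out, the three-term recurrence has only plus signs, so positivity
    -- propagates.
    refine ⟨2 * (n + 1) / x * b + a, by positivity, ?_⟩
    rw [isCylinderFamily_hankelNat.three_term n
      (CStarNonneg_subset_logUpDomain (I_mul_mem_CStarNonneg hx)), ha', hb']
    have : (x : ℂ) ≠ 0 := by exact_mod_cast hx.ne'
    have e1 : (-I) ^ (n + 1 + 1) = (-I) ^ n * -1 := by
      rw [pow_add, pow_add, pow_one]; linear_combination (-I) ^ n * I_sq
    have e2 : (-I) ^ (n + 2 + 1) = (-I) ^ n * I := by
      rw [pow_add, pow_add, pow_one]; linear_combination -(-I) ^ n * I * I_sq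
    have e3 : 2 * ((n : ℂ) + 1) / (I * x) = -I * (2 * (n + 1) / x) := by
      rw [mul_comm, ← div_div, div_I]; ring
    rw [e1, e2, e3, pow_succ]
    push_cast
    ring

/-! ### The Hankel condition, by monotonicity along arcs. -/

theorem HasDerivAt.mul_conj {P u : ℝ → ℂ} {P' u' : ℂ} {t : ℝ} (hP : HasDerivAt P P' t)
    (hu : HasDerivAt u u' t) :
    HasDerivAt (fun t => P t * conj (u t)) (P' * conj (u t) + P t * conj u') t :=
  hP.mul hu.star

theorem HasDerivAt.complex_re {u : ℝ → ℂ} {u' : ℂ} {t : ℝ} (hu : HasDerivAt u u' t) :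
    HasDerivAt (fun t => (u t).re) u'.re t :=
  reCLM.hasFDerivAt.comp_hasDerivAt t hu

theorem HasDerivAt.complex_im {u : ℝ → ℂ} {u' : ℂ} {t : ℝ} (hu : HasDerivAt u u' t) :
    HasDerivAt (fun t => (u t).im) u'.im t :=
  imCLM.hasFDerivAt.comp_hasDerivAt t hu

/-- The function `z C_n'(z)` for a cylinder family `C`. -/
def eulerDeriv (C : ℕ → ℂ → ℂ) (n : ℕ) (z : ℂ) : ℂ := n * C n z - z * C (n + 1) z

theorem IsCylinderFamily.eulerDeriv_eq {C : ℕ → ℂ → ℂ} (h : IsCylinderFamily C) (n : ℕ) {z : ℂ}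
    (hz : z ∈ logUpDomain) : eulerDeriv C n z = z * deriv (C n) z := by
  have h0 := ne_zero_of_mem_logUpDomain hz
  rw [(h.hasDerivAt_lower n z hz).deriv, eulerDeriv]
  field_simp

/-- `H_n` and `z H_n'` share the phase `(-i)^(n+1)`, which drops out of the product. The remaining
real factors have opposite signs: `r K_0' = -r K_1` and `r K_{n+1}' = -(n+1) K_{n+1} - r K_n`. -/
theorem re_eulerDeriv_hankelNat_I_mul_neg {r : ℝ} (hr : 0 < r) (n : ℕ) :
    (eulerDeriv hankelNat n (I * r) * conj (hankelNat n (I * r))).re < 0 := by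
  have hz := CStarNonneg_subset_logUpDomain (I_mul_mem_CStarNonneg hr)
  have h0 := ne_zero_of_mem_logUpDomain hz
  have hC := isCylinderFamily_hankelNat
  obtain ⟨κ, hκ, hκ'⟩ := exists_pos_hankelNat_I_mul hr n
  have hD : ∃ δ : ℝ, δ < 0 ∧ eulerDeriv hankelNat n (I * r) = (-I) ^ (n + 1) * δ := by
    cases n with
    | zero =>
      obtain ⟨μ, hμ, hμ'⟩ := exists_pos_hankelNat_I_mul hr 1
      refine ⟨-(r * μ), by have := mul_pos hr hμ; linarith, ?_⟩
      rw [eulerDeriv, zero_add, hμ']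
      push_cast
      linear_combination -I * r * μ * I_sq
    | succ n =>
      obtain ⟨μ, hμ, hμ'⟩ := exists_pos_hankelNat_I_mul hr n
      refine ⟨-((n + 1) * κ + r * μ), by have := mul_pos hr hμ; nlinarith, ?_⟩
      rw [hC.eulerDeriv_eq _ hz, (hC.hasDerivAt_upper n _ hz).deriv, hκ', hμ',
        pow_succ (-I) (n + 1)]
      have e : I * (r : ℂ) * (((n : ℂ) + 1) / (I * r)) = n + 1 := mul_div_cancel₀ _ h0
      push_cast
      linear_combination (-I) ^ (n + 1) * I * κ * e
  obtain ⟨δ, hδ, hδ'⟩ := hD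
  rw [hδ', hκ']
  have e : (-I) ^ (n + 1) * δ * conj ((-I) ^ (n + 1) * κ) = ((δ * κ : ℝ) : ℂ) := by
    have h1 : (-I) ^ (n + 1) * conj ((-I) ^ (n + 1)) = 1 := by
      rw [map_pow, ← mul_pow, map_neg, conj_I, neg_neg, neg_mul, I_mul_I, neg_neg, one_pow]
    rw [map_mul, conj_ofReal]
    push_cast
    linear_combination (δ : ℂ) * κ * h1
  rw [e, ofReal_re]
  exact mul_neg_of_neg_of_pos hδ hκ

/-- Along circular arcs about the origin, `Re (z C_n' conj C_n)` has derivative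
`Im (z^2) |C_n|^2`. -/
theorem IsCylinderFamily.hasDerivAt_arc {C : ℕ → ℂ → ℂ} (h : IsCylinderFamily C) (n : ℕ) {r θ : ℝ}
    (hz : r * exp (I * θ) ∈ logUpDomain) :
    HasDerivAt (fun θ : ℝ => (eulerDeriv C n (r * exp (I * θ)) *
        conj (C n (r * exp (I * θ)))).re)
      (2 * r ^ 2 * Real.sin θ * Real.cos θ * normSq (C n (r * exp (I * θ)))) θ := by
  have h0 := ne_zero_of_mem_logUpDomain hz
  have hzd : HasDerivAt (fun θ : ℝ => (r : ℂ) * exp (I * θ)) (I * (r * exp (I * θ))) θ := by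
    have h1 : HasDerivAt (fun z : ℂ => I * z) I (θ : ℂ) := by
      simpa using (hasDerivAt_id (θ : ℂ)).const_mul I
    refine (h1.cexp.const_mul (r : ℂ)).comp_ofReal.congr_deriv ?_
    ring
  have hu := (h.hasDerivAt_lower n _ hz).comp θ hzd
  have hD := (h.hasDerivAt_bessel n hz).comp θ hzd
  refine (hD.mul_conj hu).complex_re.congr_deriv ?_
  have hre : (r * exp (I * θ)).re = r * Real.cos θ := by
    rw [re_ofReal_mul, mul_comm I, exp_ofReal_mul_I_re]
  have him : (r * exp (I * θ)).im = r * Real.sin θ := by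
    rw [im_ofReal_mul, mul_comm I, exp_ofReal_mul_I_im]
  simp only [Function.comp]
  generalize (r : ℂ) * exp (I * θ) = z at *
  -- By Bessel's equation the derivative is `i` times two real terms and `-z² |C_n|²`; only the
  -- latter has a real part.
  have e : (n ^ 2 / z - z) * C n z * (I * z) * conj (C n z) +
      (n * C n z - z * C (n + 1) z) * conj ((n / z * C n z - C (n + 1) z) * (I * z)) =
      I * ((n ^ 2 : ℝ) * normSq (C n z) - z ^ 2 * normSq (C n z) -
        normSq (n * C n z - z * C (n + 1) z)) := by
    have e1 : (n / z * C n z - C (n + 1) z) * (I * z) = I * (n * C n z - z * C (n + 1) z) := by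
      field_simp
    rw [e1, map_mul, conj_I, normSq_eq_conj_mul_self, normSq_eq_conj_mul_self]
    push_cast
    field_simp
    ring
  rw [e]
  simp [pow_two, hre, him]
  left
  ring

/-- On the semicircle through `z`, `sin θ cos θ` changes sign once, at `θ = π/2`, so the maximum is
the negative value on the imaginary axis. -/
theorem re_eulerDeriv_hankelNat_neg {z : ℂ} (hz : z ∈ CStarNonneg) (n : ℕ) :
    (eulerDeriv hankelNat n z * conj (hankelNat n z)).re < 0 := by
  have hr : 0 < ‖z‖ := norm_pos_iff.2 hz.1
  have hmem : ∀ θ ∈ Set.Icc 0 Real.pi, (‖z‖ : ℂ) * exp (I * θ) ∈ logUpDomain := by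
    intro θ hθ
    refine CStarNonneg_subset_logUpDomain ⟨?_, ?_⟩
    · exact mul_ne_zero (by exact_mod_cast hr.ne') (exp_ne_zero _)
    · rw [im_ofReal_mul, mul_comm I, exp_ofReal_mul_I_im]
      exact mul_nonneg hr.le (Real.sin_nonneg_of_mem_Icc hθ)
  have hd := fun θ hθ => isCylinderFamily_hankelNat.hasDerivAt_arc n (hmem θ hθ)
  set g : ℝ → ℝ := fun θ : ℝ => (eulerDeriv hankelNat n (‖z‖ * exp (I * θ)) *
        conj (hankelNat n (‖z‖ * exp (I * θ)))).re with hg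
  have htop : g (Real.pi / 2) < 0 := by
    have := re_eulerDeriv_hankelNat_I_mul_neg hr n
    have e : (‖z‖ : ℂ) * exp (I * (Real.pi / 2 : ℝ)) = I * ‖z‖ := by
      rw [mul_comm I]
      push_cast
      rw [exp_pi_div_two_mul_I, mul_comm]
    rw [hg]
    dsimp only
    rw [e]
    exact this
  have hpi := Real.pi_pos
  have hmono : MonotoneOn g (Set.Icc 0 (Real.pi / 2)) := by
    have hsub : ∀ θ ∈ Set.Icc 0 (Real.pi / 2), θ ∈ Set.Icc 0 Real.pi :=
      fun θ hθ => ⟨hθ.1, by linarith [hθ.2]⟩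
    refine monotoneOn_of_deriv_nonneg (convex_Icc _ _)
      (fun θ hθ => (hd θ (hsub θ hθ)).continuousAt.continuousWithinAt)
      (fun θ hθ => (hd θ (hsub θ (interior_subset hθ))).differentiableAt.differentiableWithinAt) ?_
    intro θ hθ
    have hθ' := interior_subset hθ
    rw [(hd θ (hsub θ hθ')).deriv]
    have h1 := Real.sin_nonneg_of_mem_Icc (hsub θ hθ')
    have h2 := Real.cos_nonneg_of_mem_Icc (x := θ) ⟨by linarith [hθ'.1], hθ'.2⟩
    have h3 := normSq_nonneg (hankelNat n (‖z‖ * exp (I * θ)))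
    positivity
  have hanti : AntitoneOn g (Set.Icc (Real.pi / 2) Real.pi) := by
    have hsub : ∀ θ ∈ Set.Icc (Real.pi / 2) Real.pi, θ ∈ Set.Icc 0 Real.pi :=
      fun θ hθ => ⟨by linarith [hθ.1], hθ.2⟩
    refine antitoneOn_of_deriv_nonpos (convex_Icc _ _)
      (fun θ hθ => (hd θ (hsub θ hθ)).continuousAt.continuousWithinAt)
      (fun θ hθ => (hd θ (hsub θ (interior_subset hθ))).differentiableAt.differentiableWithinAt) ?_
    intro θ hθ
    have hθ' := interior_subset hθ
    rw [(hd θ (hsub θ hθ')).deriv]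
    have h1 := Real.sin_nonneg_of_mem_Icc (hsub θ hθ')
    have h2 := Real.cos_nonpos_of_pi_div_two_le_of_le hθ'.1 (by linarith [hθ'.2])
    have h3 := normSq_nonneg (hankelNat n (‖z‖ * exp (I * θ)))
    refine mul_nonpos_of_nonpos_of_nonneg (mul_nonpos_of_nonneg_of_nonpos (by positivity) h2) h3
  have harg0 : 0 ≤ arg z := arg_nonneg_iff.2 hz.2
  have harg1 := arg_le_pi z
  have hle : g (arg z) ≤ g (Real.pi / 2) := by
    rcases le_total (arg z) (Real.pi / 2) with h | h
    · exact hmono ⟨harg0, h⟩ ⟨by linarith, le_rfl⟩ h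
    · exact hanti ⟨le_rfl, by linarith⟩ ⟨h, harg1⟩ h
  have e : (‖z‖ : ℂ) * exp (I * arg z) = z := by
    rw [mul_comm I, norm_mul_exp_arg_mul_I]
  rw [hg] at hle htop
  dsimp only at hle htop
  rw [e] at hle
  exact hle.trans_lt htop

theorem deriv_hankelNat_add_I_mul_ne_zero {z : ℂ} (hz : z ∈ CStarNonneg) (n : ℕ) :
    deriv (hankelNat n) z + I * hankelNat n z ≠ 0 := by
  intro h
  have h1 := re_eulerDeriv_hankelNat_neg hz n
  rw [isCylinderFamily_hankelNat.eulerDeriv_eq n (CStarNonneg_subset_logUpDomain hz)] at h1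
  have e : z * deriv (hankelNat n) z * conj (hankelNat n z) =
      -I * z * normSq (hankelNat n z) := by
    rw [normSq_eq_conj_mul_self]
    linear_combination z * conj (hankelNat n z) * h
  rw [e, re_mul_ofReal] at h1
  have h2 : (-I * z).re = z.im := by simp
  rw [h2] at h1
  exact absurd h1 (not_lt.2 (mul_nonneg hz.2 (normSq_nonneg _)))

/-! ### The Bessel condition, by monotonicity along rays. -/

/-- Shows `n ! · jSeries n w → 1` as `n → ∞`, so `J_n(z)` cannot vanish for all large orders. -/
theorem norm_jSeries_sub_le (n : ℕ) (w : ℂ) :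
    ‖jSeries n w - 1 / (n ! : ℂ)‖ ≤ Real.exp ‖w‖ / (n + 1)! := by
  have hJ := summable_of_le_factorial (norm_jCoeff_le n) w
  have e : jSeries n w - 1 / (n ! : ℂ) = ∑' j, jCoeff n (j + 1) * w ^ (j + 1) := by
    rw [jSeries, hJ.tsum_eq_zero_add]
    simp [jCoeff]
  have hexp : HasSum (fun j : ℕ => ‖w‖ ^ j / j !) (Real.exp ‖w‖) := by
    rw [Real.exp_eq_exp_ℝ]
    exact NormedSpace.expSeries_div_hasSum_exp ‖w‖
  have hexp' : HasSum (fun j : ℕ => ‖w‖ ^ (j + 1) / (j + 1)! / (n + 1)!)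
      ((Real.exp ‖w‖ - 1) / (n + 1)!) := by
    have := (hasSum_nat_add_iff' 1).2 hexp
    simpa using this.div_const ((n + 1)! : ℝ)
  rw [e]
  refine (tsum_of_norm_bounded hexp' fun j => ?_).trans ?_
  · have hf : ((n + 1)! : ℝ) ≤ ((j + 1 + n)! : ℝ) := by
      exact_mod_cast Nat.factorial_le (by omega)
    rw [jCoeff, norm_mul, norm_div, norm_mul, norm_pow, norm_pow, norm_neg, norm_one, one_pow,
      norm_natCast, norm_natCast, one_div_mul_eq_div, div_div]
    exact div_le_div_of_nonneg_left (by positivity) (by positivity)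
      (mul_le_mul_of_nonneg_left hf (by positivity))
  · gcongr
    linarith

theorem exists_jSeries_ne_zero (n : ℕ) (w : ℂ) : ∃ k, jSeries (n + k) w ≠ 0 := by
  obtain ⟨k, hk⟩ := exists_nat_gt (Real.exp ‖w‖)
  refine ⟨k, fun h => ?_⟩
  have h1 := norm_jSeries_sub_le (n + k) w
  rw [h, zero_sub, norm_neg, norm_div, norm_one, norm_natCast, Nat.factorial_succ] at h1
  push_cast at h1
  have h2 : (0 : ℝ) < ((n + k)! : ℝ) := by positivity
  rw [div_le_div_iff₀ h2 (by positivity)] at h1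
  have h3 : (0 : ℝ) ≤ n := n.cast_nonneg
  nlinarith

/-- Two consecutive zeros would propagate to all higher orders through the three-term recurrence. -/
theorem besselJNat_succ_ne_zero {z : ℂ} (hz : z ∈ CStarNonneg) (n : ℕ) (h0 : besselJNat n z = 0) :
    besselJNat (n + 1) z ≠ 0 := by
  intro h1
  have h : ∀ k, besselJNat (n + k) z = 0 := by
    intro k
    induction k using Nat.twoStepInduction with
    | zero => exact h0
    | one => exact h1
    | more k ih ih' =>
      rw [← add_assoc, isCylinderFamily_besselJNat.three_term (n + k)
        (CStarNonneg_subset_logUpDomain hz), ih, add_assoc, ih']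
      simp
  obtain ⟨k, hk⟩ := exists_jSeries_ne_zero n ((z / 2) ^ 2)
  have := h k
  rw [besselJNat_eq] at this
  exact mul_ne_zero (pow_ne_zero _ (div_ne_zero hz.1 two_ne_zero)) hk this

theorem ofReal_mul_mem_CStarNonneg {z : ℂ} (hz : z ∈ CStarNonneg) {t : ℝ} (ht : 0 < t) :
    z * t ∈ CStarNonneg :=
  ⟨mul_ne_zero hz.1 (by exact_mod_cast ht.ne'), by
    rw [im_mul_ofReal]; exact mul_nonneg hz.2 ht.le⟩

theorem im_conj_mul_eulerDeriv_besselJNat_nonpos {z : ℂ} (hz : z ∈ CStarNonneg) (n : ℕ) :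
    (conj z * (eulerDeriv besselJNat n z * conj (besselJNat n z))).im ≤ 0 := by
  have hC := isCylinderFamily_besselJNat
  have hd : ∀ t : ℝ, 0 < t → HasDerivAt
      (fun t : ℝ => (conj z * (eulerDeriv besselJNat n (z * t) * conj (besselJNat n (z * t)))).im)
      (-(z.im * ((n ^ 2 / t + t * normSq z) * normSq (besselJNat n (z * t)) +
        normSq (eulerDeriv besselJNat n (z * t)) / t))) t := by
    intro t ht
    have hm := CStarNonneg_subset_logUpDomain (ofReal_mul_mem_CStarNonneg hz ht)
    have hzd : HasDerivAt (fun t : ℝ => z * (t : ℂ)) z t := by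
      simpa using (((hasDerivAt_id (t : ℂ)).const_mul z).comp_ofReal)
    have hu := (hC.hasDerivAt_lower n _ hm).comp t hzd
    have hD := (hC.hasDerivAt_bessel n hm).comp t hzd
    refine ((hD.mul_conj hu).const_mul (conj z)).complex_im.congr_deriv ?_
    have ht0 : (t : ℂ) ≠ 0 := by exact_mod_cast ht.ne'
    have hz0 := hz.1
    have e1 : (n / (z * t) * besselJNat n (z * t) - besselJNat (n + 1) (z * t)) * z =
        eulerDeriv besselJNat n (z * t) / t := by
      rw [eulerDeriv]
      field_simp
    have e : conj z * ((n ^ 2 / (z * t) - z * t) * besselJNat n (z * t) * z *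
        conj (besselJNat n (z * t)) +
        eulerDeriv besselJNat n (z * t) * conj (eulerDeriv besselJNat n (z * t) / t)) =
        conj z * (n ^ 2 / t * normSq (besselJNat n (z * t)) +
          normSq (eulerDeriv besselJNat n (z * t)) / t : ℝ) -
        z * (t * normSq z * normSq (besselJNat n (z * t)) : ℝ) := by
      rw [map_div₀, conj_ofReal]
      push_cast
      rw [normSq_eq_conj_mul_self, normSq_eq_conj_mul_self, normSq_eq_conj_mul_self]
      field_simp
      ring
    simp only [Function.comp]
    rw [e1]
    change (conj z * ((n ^ 2 / (z * t) - z * t) * besselJNat n (z * t) * z *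
        conj (besselJNat n (z * t)) +
        eulerDeriv besselJNat n (z * t) * conj (eulerDeriv besselJNat n (z * t) / t))).im = _
    rw [e, sub_im, im_mul_ofReal, im_mul_ofReal, conj_im]
    ring
  -- At `t = 0` the point `z * t` leaves `logUpDomain`; continuity of the entire functions `J_n` and
  -- `J_{n+1}` is enough there.
  have hanti : AntitoneOn
      (fun t : ℝ => (conj z * (eulerDeriv besselJNat n (z * t) * conj (besselJNat n (z * t)))).im)
      (Set.Icc 0 1) := by
    refine antitoneOn_of_deriv_nonpos (convex_Icc _ _) ?_ ?_ ?_
    · have h1 := (differentiable_besselJNat n).continuous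
      have h2 := (differentiable_besselJNat (n + 1)).continuous
      unfold eulerDeriv
      fun_prop
    · rw [interior_Icc]
      exact fun t ht => (hd t ht.1).differentiableAt.differentiableWithinAt
    · rw [interior_Icc]
      intro t ht
      have ht0 : 0 < t := ht.1
      rw [(hd t ht0).deriv, neg_nonpos]
      refine mul_nonneg hz.2 ?_
      have h1 := normSq_nonneg z
      have h2 := normSq_nonneg (besselJNat n (z * t))
      have h3 := normSq_nonneg (eulerDeriv besselJNat n (z * t))
      positivity
  have h0 : eulerDeriv besselJNat n 0 = 0 := by
    rw [eulerDeriv, besselJNat_eq]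
    cases n <;> simp
  have h := hanti (Set.left_mem_Icc.2 zero_le_one) (Set.right_mem_Icc.2 zero_le_one) zero_le_one
  simpa [h0] using h

theorem deriv_besselJNat_sub_I_mul_ne_zero {z : ℂ} (hz : z ∈ CStarNonneg) (n : ℕ) :
    deriv (besselJNat n) z - I * besselJNat n z ≠ 0 := by
  intro h
  have hm := CStarNonneg_subset_logUpDomain hz
  have h1 := im_conj_mul_eulerDeriv_besselJNat_nonpos hz n
  have hD := isCylinderFamily_besselJNat.eulerDeriv_eq n hm
  rw [hD] at h1
  have e : conj z * (z * deriv (besselJNat n) z * conj (besselJNat n z)) =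
      I * (normSq z * normSq (besselJNat n z) : ℝ) := by
    push_cast
    rw [normSq_eq_conj_mul_self, normSq_eq_conj_mul_self]
    linear_combination conj z * z * conj (besselJNat n z) * h
  rw [e, im_mul_ofReal, I_im, one_mul] at h1
  have hJ : besselJNat n z = 0 :=
    normSq_eq_zero.1 (le_antisymm (nonpos_of_mul_nonpos_right h1 (normSq_pos.2 hz.1))
      (normSq_nonneg _))
  rw [hJ, mul_zero, sub_zero] at h
  -- With `J_n = J_n' = 0`, the relation `z J_n' = n J_n - z J_{n+1}` gives `J_{n+1} = 0`.
  rw [h, mul_zero, eulerDeriv, hJ, mul_zero, zero_sub, neg_eq_zero] at hD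
  exact besselJNat_succ_ne_zero hz n hJ ((mul_eq_zero.1 hD).resolve_left hz.1)

/-! ### Integer orders and the scaling constants. -/

theorem orderSign_ne_zero (m : ℤ) : orderSign m ≠ 0 := by
  rw [orderSign]
  split_ifs
  · exact pow_ne_zero _ (by simp)
  · exact one_ne_zero

theorem existsUnique_one_div_eq {w : ℂ} (hw : w ≠ 0) : ∃! c : ℂ, c ≠ 0 ∧ 1 / c = w := by
  refine ⟨w⁻¹, ⟨inv_ne_zero hw, by simp⟩, ?_⟩
  rintro c ⟨-, rfl⟩
  simp

theorem deriv_besselJ_sub_I_mul_ne_zero (m : ℤ) {z : ℂ} (hz : z ∈ CStarNonneg) :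
    deriv (besselJ m) z - I * besselJ m z ≠ 0 := by
  have hd : deriv (besselJ m) z = orderSign m * deriv (besselJNat m.natAbs) z :=
    ((differentiable_besselJNat m.natAbs z).hasDerivAt.const_mul (orderSign m)).deriv
  have e : deriv (besselJ m) z - I * besselJ m z =
      orderSign m * (deriv (besselJNat m.natAbs) z - I * besselJNat m.natAbs z) := by
    rw [hd, besselJ]
    ring
  rw [e]
  exact mul_ne_zero (orderSign_ne_zero m) (deriv_besselJNat_sub_I_mul_ne_zero hz _)

theorem deriv_hankelH_add_I_mul_ne_zero (m : ℤ) {z : ℂ} (hz : z ∈ CStarNonneg) :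
    deriv (hankelH m) z + I * hankelH m z ≠ 0 := by
  have hH : hankelH m = fun z => orderSign m * hankelNat m.natAbs z := by
    funext z
    rw [hankelH, besselJ, besselY, hankelNat]
    ring
  have hd : deriv (hankelH m) z = orderSign m * deriv (hankelNat m.natAbs) z := by
    rw [hH]
    exact ((isCylinderFamily_hankelNat.hasDerivAt_lower m.natAbs z
      (CStarNonneg_subset_logUpDomain hz)).differentiableAt.hasDerivAt.const_mul
      (orderSign m)).deriv
  have e : deriv (hankelH m) z + I * hankelH m z =
      orderSign m * (deriv (hankelNat m.natAbs) z + I * hankelNat m.natAbs z) := by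
    rw [hd, hH]
    ring
  rw [e]
  exact mul_ne_zero (orderSign_ne_zero m) (deriv_hankelNat_add_I_mul_ne_zero hz _)

end

theorem lemma5p1 (m : ℤ) (n₁ n₂ : ℝ) (hn₁ : 0 < n₁) (hn₂ : 0 < n₂)
    (k : ℂ) (hk : k ∈ CStarNonneg) (ξ : ℝ) (hξ : ξ ∈ Set.Ioo (0 : ℝ) 1) :
    deriv (besselJ m) (k * ξ * n₁) - I * besselJ m (k * ξ * n₁) ≠ 0 ∧
    deriv (hankelH m) (k * ξ * n₂) + I * hankelH m (k * ξ * n₂) ≠ 0 ∧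
    (∃! c₁ : ℂ, c₁ ≠ 0 ∧
      1 / c₁ = k * n₁ * (deriv (besselJ m) (k * ξ * n₁) - I * besselJ m (k * ξ * n₁))) ∧
    (∃! c₂ : ℂ, c₂ ≠ 0 ∧
      1 / c₂ = -(k * n₂) * (deriv (hankelH m) (k * ξ * n₂) + I * hankelH m (k * ξ * n₂))) := by
  have h₁ := deriv_besselJ_sub_I_mul_ne_zero m
    (ofReal_mul_mem_CStarNonneg (ofReal_mul_mem_CStarNonneg hk hξ.1) hn₁)
  have h₂ := deriv_hankelH_add_I_mul_ne_zero m
    (ofReal_mul_mem_CStarNonneg (ofReal_mul_mem_CStarNonneg hk hξ.1) hn₂)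
  have hkn : ∀ {n : ℝ}, 0 < n → k * n ≠ 0 := fun hn =>
    mul_ne_zero hk.1 (ofReal_ne_zero.2 hn.ne')
  exact ⟨h₁, h₂, existsUnique_one_div_eq (mul_ne_zero (hkn hn₁) h₁),
    existsUnique_one_div_eq (mul_ne_zero (neg_ne_zero.2 (hkn hn₂)) h₂)⟩
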